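/- Let $S$ be a set of $n \ge 4$ points in the Euclidean plane in general position, meaning that no three points of $S$ are collinear and no four points of $S$ are cocircular. For $1 \le k \le n-1$, the order-$k$ Voronoi diagram $V_k(S)$ is the subdivision of the plane into cells such that points in the same cell have the same $k$ nearest points of $S$; its vertices are the points of the plane that lie in the closures of at least three cells. Let $v_k$ be the number of vertices of $V_k(S)$ (which is finite), and let $p_V(z)=\sum_{k=1}^{n-1} v_k z^{k-1}$ be the Voronoi polynomial of $S$. Let $\overline{cr}(S)$ be the number of unordered pairs of edges that cross (that is, have a common point in their relative interiors) in the drawing of the complete graph on the vertex set $S$ with straight-line segments as edges. Then 1. $p_V(1)=2\binom{n}{3}$; 2. $p_V'(1)=\binom{n}{3}+2\binom{n}{4}+2\,\overline{cr}(S)$; 3. $p_V''(1)=2\binom{n}{4}+2\binom{n}{5}+2(n-3)\,\overline{cr}(S)$; 4. $p_V(-1)=0$; 5. if $n$ is odd, then $p_V'(-1)=\frac{n-1}{2}$. -/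

import Mathlib

open Polynomial

noncomputable section

/-- The Euclidean plane. -/
abbrev Plane : Type := EuclideanSpace ℝ (Fin 2)

/-- A finite point set is in general position if no three of its points are collinear and no four
of its points are cocircular (in the plane, `Cospherical` means lying on a common circle). -/
def GeneralPosition (S : Finset Plane) : Prop :=
  (∀ T : Finset Plane, T ⊆ S → T.card = 3 → ¬ Collinear ℝ (T : Set Plane)) ∧
  (∀ T : Finset Plane, T ⊆ S → T.card = 4 → ¬ EuclideanGeometry.Cospherical (T : Set Plane))

/-- The (open) Voronoi cell of a subset `T` of `S`: the points of the plane that are strictly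
closer to every point of `T` than to every other point of `S`. For `T` with `k` elements, it
consists of the points whose `k` nearest points of `S` are exactly those in `T`. -/
def voronoiCell (S T : Finset Plane) : Set Plane :=
  {x | ∀ p ∈ T, ∀ q ∈ S, q ∉ T → dist x p < dist x q}

/-- The vertices of the order-`k` Voronoi diagram of `S`: the points of the plane where at least
three cells meet, that is, which lie in the closures of at least three cells. -/
def voronoiVertices (S : Finset Plane) (k : ℕ) : Set Plane :=
  {x | 3 ≤ {T : Finset Plane | T ⊆ S ∧ T.card = k ∧ x ∈ closure (voronoiCell S T)}.encard}

/-- The Voronoi polynomial `∑_{k=1}^{n-1} v_k z^{k-1}`, where `n` is the number of points and `v_k`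
is the number of vertices of the order-`k` Voronoi diagram. -/
def voronoiPolynomial (S : Finset Plane) : ℝ[X] :=
  ∑ k ∈ Finset.Icc 1 (S.card - 1), C ((voronoiVertices S k).ncard : ℝ) * X ^ (k - 1)

/-- The rectilinear crossing number of `S`: the number of unordered pairs of distinct edges of the
complete straight-line graph on `S` that cross, that is, whose relative interiors (the segments
without their end points) meet. -/
def crossingNumber (S : Finset Plane) : ℕ :=
  {P : Sym2 (Sym2 Plane) | ∃ a ∈ S, ∃ b ∈ S, ∃ c ∈ S, ∃ d ∈ S,
    a ≠ b ∧ c ≠ d ∧ s(a, b) ≠ s(c, d) ∧ P = s(s(a, b), s(c, d)) ∧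
    (openSegment ℝ a b ∩ openSegment ℝ c d).Nonempty}.ncard

end

open Polynomial

noncomputable section

/-! Since no four points are cocircular, a Voronoi vertex is the center of a circle through exactly
three points of `S`, and a circle with `c` points inside yields a vertex in the orders `c + 1` and
`c + 2` only. Hence the polynomial is the sum of `(1 + z) z ^ c` over all triples
(`voronoiPolynomial_eq_sum`). Its values at `1` and `-1` are immediate, its derivatives at `1` are
governed by the first two moments of `c`, and its derivative at `-1` is the sum of `(-1) ^ c`.

The first moment counts pairs of a triple and a point inside its circle. Grouped by four-point
subsets, each subset accounts for one such pair, or for two if it spans a crossing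
(`sum_inside_four`).

Everything else follows from `sum_prod_circleSign_of_card_odd`: in a set of `2m + 1` points the sum
of `(-1) ^ c` over all triples is `m`. The case `m = 2`, summed over the five-point subsets, yields
the second moment. The induction removes a point `q` and its nearest neighbor `p`. Lifted to the
paraboloid, being inside a circle is a sign of a 4×4 determinant, and for odd size `(-1) ^ c` is a
plain product of such signs. The triples containing both `p` and `q` sum to `1`, because the circle
with diameter `pq` is empty. The triples containing one of them are rewritten by Plücker relations
as sums over triples of the remaining points, where they exactly offset the sign changes caused by
`p` and `q` (`chi_relation`). -/

/-- Twice the signed area of the triangle `abc`. -/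
def orient (a b c : Plane) : ℝ := (b 0 - a 0) * (c 1 - a 1) - (b 1 - a 1) * (c 0 - a 0)

/-- The squared Euclidean distance in coordinates. -/
def sqDist (a b : Plane) : ℝ := (a 0 - b 0) ^ 2 + (a 1 - b 1) ^ 2

/-- The in-circle determinant of four points. -/
def inCircle (a b c d : Plane) : ℝ :=
  orient b c d * sqDist a 0 - orient a c d * sqDist b 0 + orient a b d * sqDist c 0
    - orient a b c * sqDist d 0

/-! ### Distances, circumcenters and in-circle determinants in coordinates -/

theorem dist_sq_eq_sqDist (a b : Plane) : dist a b ^ 2 = sqDist a b := by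
  rw [EuclideanSpace.dist_eq, Real.sq_sqrt (by positivity)]
  simp [sqDist, Fin.sum_univ_two, Real.dist_eq, sq_abs]

theorem dist_eq_sqrt_sqDist (a b : Plane) : dist a b = √(sqDist a b) := by
  rw [← dist_sq_eq_sqDist, Real.sqrt_sq dist_nonneg]

theorem sqDist_nonneg (a b : Plane) : 0 ≤ sqDist a b := by unfold sqDist; positivity

theorem sqDist_pos {a b : Plane} (h : a ≠ b) : 0 < sqDist a b := by
  rw [← dist_sq_eq_sqDist]; have := dist_pos.2 h; positivity

theorem sqDist_self (a : Plane) : sqDist a a = 0 := by simp [sqDist]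

theorem dist_lt_dist_iff {a b c d : Plane} : dist a b < dist c d ↔ sqDist a b < sqDist c d := by
  rw [dist_eq_sqrt_sqDist, dist_eq_sqrt_sqDist, Real.sqrt_lt_sqrt_iff (sqDist_nonneg _ _)]

theorem dist_le_dist_iff {a b c d : Plane} : dist a b ≤ dist c d ↔ sqDist a b ≤ sqDist c d := by
  rw [← not_lt, dist_lt_dist_iff, not_lt]

theorem dist_eq_dist_iff {a b c d : Plane} : dist a b = dist c d ↔ sqDist a b = sqDist c d := by
  rw [le_antisymm_iff, le_antisymm_iff, dist_le_dist_iff, dist_le_dist_iff]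

/-- Expansion of the in-circle determinant along the column of squared distances to `e`. -/
theorem inCircle_eq (a b c d e : Plane) :
    inCircle a b c d = orient b c d * sqDist a e - orient a c d * sqDist b e
      + orient a b d * sqDist c e - orient a b c * sqDist d e := by
  simp only [inCircle, orient, sqDist, PiLp.zero_apply]; ring

/-- The same expansion for the power with respect to a circle with center `e`. -/
theorem inCircle_eq_of_center {a b c e : Plane} {R : ℝ} (ha : sqDist a e = R)
    (hb : sqDist b e = R) (hc : sqDist c e = R) (d : Plane) :
    inCircle a b c d = orient a b c * (R - sqDist d e) := by
  rw [inCircle_eq a b c d e, ha, hb, hc]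
  simp only [orient]; ring

theorem exists_center {a b c : Plane} (h : orient a b c ≠ 0) :
    ∃ e : Plane, sqDist b e = sqDist a e ∧ sqDist c e = sqDist a e := by
  set D := 2 * orient a b c with hD
  have hD0 : D ≠ 0 := by positivity
  -- Cramer's rule for the bisector equations of `ab` and `ac`, with the origin at `a`.
  set u : ℝ := ((c 1 - a 1) * sqDist b a - (b 1 - a 1) * sqDist c a) / D with hu
  set v : ℝ := ((b 0 - a 0) * sqDist c a - (c 0 - a 0) * sqDist b a) / D with hv
  have hu' : u * D = (c 1 - a 1) * sqDist b a - (b 1 - a 1) * sqDist c a := by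
    rw [hu, div_mul_cancel₀ _ hD0]
  have hv' : v * D = (b 0 - a 0) * sqDist c a - (c 0 - a 0) * sqDist b a := by
    rw [hv, div_mul_cancel₀ _ hD0]
  obtain ⟨e, he0, he1⟩ : ∃ e : Plane, e 0 = a 0 + u ∧ e 1 = a 1 + v :=
    ⟨!₂[a 0 + u, a 1 + v], rfl, rfl⟩
  refine ⟨e, mul_left_cancel₀ hD0 ?_, mul_left_cancel₀ hD0 ?_⟩
  all_goals simp only [sqDist, orient, he0, he1] at *
  · linear_combination (-2) * (b 0 - a 0) * hu' - 2 * (b 1 - a 1) * hv'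
      + ((b 0 - a 0) ^ 2 + (b 1 - a 1) ^ 2) * hD
  · linear_combination (-2) * (c 0 - a 0) * hu' - 2 * (c 1 - a 1) * hv'
      + ((c 0 - a 0) ^ 2 + (c 1 - a 1) ^ 2) * hD

theorem center_unique {a b c e f : Plane} (h : orient a b c ≠ 0)
    (hbe : sqDist b e = sqDist a e) (hce : sqDist c e = sqDist a e)
    (hbf : sqDist b f = sqDist a f) (hcf : sqDist c f = sqDist a f) : e = f := by
  have h0 : orient a b c * (e 0 - f 0) = 0 := by
    simp only [sqDist, orient] at *
    linear_combination (1/2) * ((b 1 - a 1) * (hce - hcf) - (c 1 - a 1) * (hbe - hbf))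
  have h1 : orient a b c * (e 1 - f 1) = 0 := by
    simp only [sqDist, orient] at *
    linear_combination (1/2) * ((c 0 - a 0) * (hbe - hbf) - (b 0 - a 0) * (hce - hcf))
  ext i
  fin_cases i
  · simpa [h, sub_eq_zero] using h0
  · simpa [h, sub_eq_zero] using h1

theorem collinear_of_orient_eq_zero {a b c : Plane} (h : orient a b c = 0) :
    Collinear ℝ ({a, b, c} : Set Plane) := by
  by_cases hab : b = a
  · subst hab
    simpa using collinear_pair ℝ b c
  rw [collinear_iff_of_mem (p₀ := a) (by simp)]
  have hR : sqDist b a ≠ 0 := (sqDist_pos hab).ne'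
  refine ⟨b - a, ?_⟩
  simp only [Set.mem_insert_iff, Set.mem_singleton_iff, forall_eq_or_imp, forall_eq]
  refine ⟨⟨0, by simp⟩, ⟨1, by simp⟩,
    ⟨((c 0 - a 0) * (b 0 - a 0) + (c 1 - a 1) * (b 1 - a 1)) / sqDist b a, ?_⟩⟩
  ext i
  simp only [orient] at h
  fin_cases i <;> simp <;> field_simp <;> simp only [sqDist]
  · linear_combination (b 1 - a 1) * (-h)
  · linear_combination (b 0 - a 0) * h

theorem GeneralPosition.mono {S T : Finset Plane} (hS : GeneralPosition S) (h : T ⊆ S) :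
    GeneralPosition T :=
  ⟨fun U hU => hS.1 U (hU.trans h), fun U hU => hS.2 U (hU.trans h)⟩

theorem GeneralPosition.orient_ne_zero {S : Finset Plane} (hS : GeneralPosition S) {a b c : Plane}
    (ha : a ∈ S) (hb : b ∈ S) (hc : c ∈ S) (hab : a ≠ b) (hac : a ≠ c) (hbc : b ≠ c) :
    orient a b c ≠ 0 := by
  intro h
  refine hS.1 {a, b, c} ?_ (Finset.card_eq_three.2 ⟨a, b, c, hab, hac, hbc, rfl⟩) ?_
  · intro x; simp; rintro (rfl | rfl | rfl) <;> assumption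
  · simpa using collinear_of_orient_eq_zero h

theorem GeneralPosition.inCircle_ne_zero {S : Finset Plane} (hS : GeneralPosition S)
    {a b c d : Plane} (ha : a ∈ S) (hb : b ∈ S) (hc : c ∈ S) (hd : d ∈ S) (hab : a ≠ b)
    (hac : a ≠ c) (hbc : b ≠ c) (had : a ≠ d) (hbd : b ≠ d) (hcd : c ≠ d) :
    inCircle a b c d ≠ 0 := by
  intro h
  have ho := hS.orient_ne_zero ha hb hc hab hac hbc
  obtain ⟨e, h1, h2⟩ := exists_center ho
  rw [inCircle_eq_of_center rfl h1 h2] at h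
  have hd' : sqDist d e = sqDist a e := by
    rcases mul_eq_zero.1 h with h | h
    · exact absurd h ho
    · linarith
  refine hS.2 {a, b, c, d} ?_ ?_ ⟨e, dist a e, ?_⟩
  · intro x; simp; rintro (rfl | rfl | rfl | rfl) <;> assumption
  · simp [*]
  · simp [dist_eq_dist_iff, *]

/-! ### Sign sums of rank-two alternating forms -/

/-- Only the rank of `t c` matters: an element with `j` smaller values contributes `(-1) ^ j`, so
the sum is `1 - 1 + 1 - ⋯`. -/
theorem sum_prod_sign_sub {ι : Type*} [DecidableEq ι] (s : Finset ι) (t : ι → ℝ)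
    (ht : Set.InjOn t s) :
    ∑ c ∈ s, ∏ d ∈ s.erase c, (SignType.sign (t d - t c) : ℤ) = if Even s.card then 0 else 1 := by
  induction s using Finset.induction_on_max_value t with
  | empty => simp
  | insert m s hm hmax ih =>
    have hlt : ∀ c ∈ s, t c < t m := fun c hc => lt_of_le_of_ne (hmax c hc) fun h => by
      have := ht (by simp [hc]) (by simp) h
      exact hm (this ▸ hc)
    rw [Finset.sum_insert hm, Finset.erase_insert hm]
    have h1 : ∏ d ∈ s, (SignType.sign (t d - t m) : ℤ) = (-1) ^ s.card := by
      rw [Finset.prod_congr rfl (g := fun _ => (-1 : ℤ)) fun d hd => by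
        rw [sign_neg (sub_neg.2 (hlt d hd))]; rfl]
      simp
    have h2 : ∀ c ∈ s, ∏ d ∈ (insert m s).erase c, (SignType.sign (t d - t c) : ℤ)
        = ∏ d ∈ s.erase c, (SignType.sign (t d - t c) : ℤ) := fun c hc => by
      rw [Finset.erase_insert_of_ne (fun h : m = c => hm (h ▸ hc)), Finset.prod_insert (by simp [hm]),
        sign_pos (sub_pos.2 (hlt c hc))]
      simp
    rw [h1, Finset.sum_congr rfl h2, ih (ht.mono (by simp)), Finset.card_insert_of_notMem hm]
    rcases Nat.even_or_odd s.card with h | h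
    · simp [h, h.neg_one_pow, Nat.even_add_one]
    · simp [Nat.not_even_iff_odd.2 h, h.neg_one_pow, Nat.even_add_one]

theorem sign_cast_mul_self {x : ℝ} (h : x ≠ 0) :
    (SignType.sign x : ℤ) * (SignType.sign x : ℤ) = 1 := by
  rcases lt_or_gt_of_ne h with h | h
  · simp [sign_neg h]
  · simp [sign_pos h]

theorem sign_cast_mul (x y : ℝ) :
    (SignType.sign (x * y) : ℤ) = (SignType.sign x : ℤ) * (SignType.sign y : ℤ) := by
  rw [sign_mul]; push_cast; rfl

/-- The sign of `x c` enters the inner product `s.card - 1` times, an even number, so rescaling by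
`x` costs only the global factor on the right. -/
theorem sum_sign_mul_prod_sign {ι : Type*} [DecidableEq ι] {s : Finset ι} (hs : Odd s.card)
    {D : ι → ι → ℝ} {x t : ι → ℝ} (hx : ∀ c ∈ s, x c ≠ 0)
    (hD : ∀ c ∈ s, ∀ d ∈ s, D c d = x c * x d * (t d - t c))
    (hD0 : ∀ c ∈ s, ∀ d ∈ s, c ≠ d → D c d ≠ 0) :
    ∑ c ∈ s, (SignType.sign (x c) : ℤ) * ∏ d ∈ s.erase c, (SignType.sign (D c d) : ℤ)
      = ∏ c ∈ s, (SignType.sign (x c) : ℤ) := by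
  have ht : Set.InjOn t s := fun c hc d hd h => by
    by_contra hne
    exact hD0 c hc d hd hne (by rw [hD c hc d hd, h]; simp)
  have key : ∀ c ∈ s, (SignType.sign (x c) : ℤ) * ∏ d ∈ s.erase c, (SignType.sign (D c d) : ℤ)
      = (∏ c ∈ s, (SignType.sign (x c) : ℤ)) *
        ∏ d ∈ s.erase c, (SignType.sign (t d - t c) : ℤ) := fun c hc => by
    rw [Finset.prod_congr rfl fun d hd => by
      rw [hD c hc d (Finset.mem_of_mem_erase hd), sign_cast_mul, sign_cast_mul],
      Finset.prod_mul_distrib, Finset.prod_mul_distrib, Finset.prod_const,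
      Finset.card_erase_of_mem hc, ← Finset.mul_prod_erase s _ hc]
    obtain ⟨k, hk⟩ := hs
    rw [hk, Nat.add_sub_cancel, pow_mul, sq, sign_cast_mul_self (hx c hc), one_pow]
    ring
  rw [Finset.sum_congr rfl key, ← Finset.mul_sum, sum_prod_sign_sub s t ht,
    if_neg (Nat.not_even_iff_odd.2 hs), mul_one]

/-- The signs of a rank two alternating form satisfying the three-term Plücker relation. -/
theorem sum_prod_sign_eq_zero {ι : Type*} [DecidableEq ι] {s : Finset ι} (hs : Even s.card)
    {D : ι → ι → ℝ} (hanti : ∀ c d, D c d = -D d c)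
    (hplu : ∀ w f c d, D w f * D c d - D w c * D f d + D w d * D f c = 0)
    (hD0 : ∀ c ∈ s, ∀ d ∈ s, c ≠ d → D c d ≠ 0) :
    ∑ c ∈ s, ∏ d ∈ s.erase c, (SignType.sign (D c d) : ℤ) = 0 := by
  rcases s.eq_empty_or_nonempty with rfl | ⟨w, hw⟩
  · simp
  have hodd : Odd (s.erase w).card := by
    have := Finset.card_erase_add_one hw
    rw [← this] at hs
    exact Nat.not_even_iff_odd.1 (Nat.even_add_one.1 hs)
  obtain ⟨f, hf⟩ : (s.erase w).Nonempty := Finset.card_pos.1 hodd.pos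
  have hwne : ∀ c ∈ s.erase w, D w c ≠ 0 := fun c hc =>
    hD0 w hw c (Finset.mem_of_mem_erase hc) (Finset.ne_of_mem_erase hc).symm
  -- The Plücker relation puts `D` in the chart where `x = D w`. The resulting identity on `s.erase
  -- w` expresses the term of `w` as a sum over `c`, whose summands are the negatives of the other
  -- terms because `D c w = -D w c`.
  have key := sum_sign_mul_prod_sign hodd (D := D) (x := D w)
    (t := fun c => D f c / (D w c * D w f)) hwne
    (fun c hc d hd => by
      have h1 := hwne c hc
      have h2 := hwne d hd
      have h3 := hwne f hf
      field_simp
      linear_combination hplu w f c d)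
    (fun c hc d hd => hD0 c (Finset.mem_of_mem_erase hc) d (Finset.mem_of_mem_erase hd))
  rw [← Finset.add_sum_erase s _ hw, ← key, ← Finset.sum_add_distrib]
  refine Finset.sum_eq_zero fun c hc => ?_
  rw [Finset.erase_right_comm, ← Finset.mul_prod_erase (s.erase c) _
    (Finset.mem_erase.2 ⟨(Finset.ne_of_mem_erase hc).symm, hw⟩), hanti c w, Left.sign_neg,
    Finset.erase_right_comm]
  push_cast
  ring

/-! ### In-circle signs of lifted points -/

/-- The orientation of four points lifted to the paraboloid. -/
def chi (a b c d : Plane) : ℤ := SignType.sign (inCircle a b c d)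

theorem chi_swap_left (a b c d : Plane) : chi b a c d = -chi a b c d := by
  have : inCircle b a c d = -inCircle a b c d := by simp only [inCircle, orient]; ring
  simp only [chi, this, Left.sign_neg]; push_cast; rfl

theorem chi_swap_middle (a b c d : Plane) : chi a c b d = -chi a b c d := by
  have : inCircle a c b d = -inCircle a b c d := by simp only [inCircle, orient]; ring
  simp only [chi, this, Left.sign_neg]; push_cast; rfl

theorem chi_swap_right (a b c d : Plane) : chi a b d c = -chi a b c d := by
  have : inCircle a b d c = -inCircle a b c d := by simp only [inCircle, orient]; ring
  simp only [chi, this, Left.sign_neg]; push_cast; rfl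

/-- Fixing two rows of a 4×4 determinant leaves an alternating form of rank two in the other two
rows; this is its three-term Grassmann–Plücker relation. -/
theorem inCircle_plucker (a b w f c d : Plane) :
    inCircle a b w f * inCircle a b c d - inCircle a b w c * inCircle a b f d
      + inCircle a b w d * inCircle a b f c = 0 := by
  simp only [inCircle, orient, sqDist, PiLp.zero_apply]; ring

/-- The point `d` lies inside the circle through the points of `t`. -/
def InsideCircle (t : Finset Plane) (d : Plane) : Prop :=
  ∃ e : Plane, ∃ r : ℝ, (∀ p ∈ t, dist p e = r) ∧ dist d e < r

theorem insideCircle_iff {a b c : Plane} (h : orient a b c ≠ 0) (d : Plane) :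
    InsideCircle {a, b, c} d ↔ 0 < orient a b c * inCircle a b c d := by
  obtain ⟨e, hb, hc⟩ := exists_center h
  have h2 : 0 < orient a b c * orient a b c := mul_self_pos.2 h
  have : InsideCircle {a, b, c} d ↔ sqDist d e < sqDist a e := by
    constructor
    · rintro ⟨f, r, hf, hd⟩
      simp only [Finset.mem_insert, Finset.mem_singleton, forall_eq_or_imp, forall_eq] at hf
      obtain ⟨hfa, hfb, hfc⟩ := hf
      have : e = f := center_unique h hb hc (dist_eq_dist_iff.1 (hfb.trans hfa.symm))
        (dist_eq_dist_iff.1 (hfc.trans hfa.symm))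
      subst this
      rw [← dist_lt_dist_iff, hfa]
      exact hd
    · intro hd
      refine ⟨e, dist a e, ?_, dist_lt_dist_iff.2 hd⟩
      simp [dist_eq_dist_iff, hb, hc]
  rw [this, inCircle_eq_of_center rfl hb hc, ← mul_assoc, mul_pos_iff_of_pos_left h2, sub_pos]

/-! ### Double counting over subsets of fixed size -/

open Finset in
theorem sum_powersetCard_sdiff {α M : Type*} [DecidableEq α] [AddCommMonoid M] (s : Finset α)
    (k l : ℕ) (f : Finset α → Finset α → M) :
    ∑ u ∈ s.powersetCard (k + l), ∑ t ∈ u.powersetCard k, f t (u \ t)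
      = ∑ t ∈ s.powersetCard k, ∑ v ∈ (s \ t).powersetCard l, f t v := by
  rw [sum_sigma', sum_sigma']
  refine sum_bij' (fun x _ => ⟨x.2, x.1 \ x.2⟩) (fun x _ => ⟨x.1 ∪ x.2, x.1⟩) ?_ ?_ ?_ ?_ ?_
  · rintro ⟨u, t⟩ h
    simp only [mem_sigma, mem_powersetCard] at h ⊢
    obtain ⟨⟨hu, hk⟩, ht, hl⟩ := h
    refine ⟨⟨ht.trans hu, hl⟩, sdiff_subset_sdiff hu subset_rfl, ?_⟩
    rw [card_sdiff_of_subset ht]; omega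
  · rintro ⟨t, v⟩ h
    simp only [mem_sigma, mem_powersetCard] at h ⊢
    obtain ⟨⟨ht, hk⟩, hv, hl⟩ := h
    refine ⟨⟨union_subset ht (hv.trans sdiff_subset), ?_⟩, subset_union_left, hk⟩
    rw [card_union_of_disjoint, hk, hl]
    exact (disjoint_of_subset_left hv sdiff_disjoint).symm
  · rintro ⟨u, t⟩ h
    simp only [mem_sigma, mem_powersetCard] at h
    simp [union_eq_right.2 h.2.1]
  · rintro ⟨t, v⟩ h
    simp only [mem_sigma, mem_powersetCard] at h
    have hd : Disjoint t v := (disjoint_of_subset_left h.2.1 sdiff_disjoint).symm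
    simp [union_sdiff_cancel_left hd]
  · intros; rfl

open Finset in
theorem sum_powersetCard_one {α M : Type*} [AddCommMonoid M] (s : Finset α) (f : Finset α → M) :
    ∑ t ∈ s.powersetCard 1, f t = ∑ a ∈ s, f {a} := by
  rw [powersetCard_one, sum_map]; rfl

open Finset in
theorem sum_powersetCard_succ {α M : Type*} [DecidableEq α] [AddCommMonoid M] (s : Finset α)
    (k : ℕ) (f : Finset α → M) :
    (k + 1) • ∑ u ∈ s.powersetCard (k + 1), f u
      = ∑ t ∈ s.powersetCard k, ∑ c ∈ s \ t, f (insert c t) := by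
  have h := sum_powersetCard_sdiff s k 1 fun t v => f (t ∪ v)
  simp only [sum_powersetCard_one] at h
  rw [← sum_nsmul, sum_congr rfl (g := fun u => ∑ t ∈ u.powersetCard k, f (t ∪ u \ t)), h]
  · exact sum_congr rfl fun t _ => sum_congr rfl fun c _ => by rw [insert_eq, union_comm]
  · intro u hu
    rw [sum_congr rfl (g := fun _ => f u), sum_const, card_powersetCard, (mem_powersetCard.1 hu).2,
      Nat.choose_succ_self_right]
    intro t ht
    rw [union_sdiff_of_subset (mem_powersetCard.1 ht).1]

open Finset in
theorem two_mul_sum_powersetCard_two {α : Type*} [DecidableEq α] (s : Finset α)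
    (f : Finset α → ℤ) :
    2 * ∑ u ∈ s.powersetCard 2, f u = ∑ a ∈ s, ∑ b ∈ s, if a ≠ b then f {a, b} else 0 := by
  have h := sum_powersetCard_succ s 1 f
  rw [sum_powersetCard_one] at h
  simp only [nsmul_eq_mul] at h
  push_cast at h
  rw [h]
  refine sum_congr rfl fun a _ => ?_
  rw [← sum_filter]
  refine sum_congr ?_ fun b _ => by rw [pair_comm]
  ext b; simp [eq_comm]

open Finset in
theorem six_mul_sum_powersetCard_three {α : Type*} [DecidableEq α] (s : Finset α)
    (f : Finset α → ℤ) :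
    6 * ∑ u ∈ s.powersetCard 3, f u = ∑ a ∈ s, ∑ b ∈ s, ∑ c ∈ s,
      if a ≠ b ∧ a ≠ c ∧ b ≠ c then f {a, b, c} else 0 := by
  have h := sum_powersetCard_succ s 2 f
  simp only [nsmul_eq_mul] at h
  push_cast at h
  have h2 := two_mul_sum_powersetCard_two s fun t => ∑ c ∈ s \ t, f (insert c t)
  rw [← h] at h2
  rw [show (6 : ℤ) = 2 * 3 by norm_num, mul_assoc, h2]
  refine sum_congr rfl fun a _ => sum_congr rfl fun b _ => ?_
  split_ifs with hab
  · rw [← sum_filter]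
    refine sum_congr ?_ fun c _ => by congr 1; ext x; simp; tauto
    ext c; simp [hab, eq_comm]
  · simp [hab]

open Finset in
theorem sum_sdiff_eq_sum_erase {α M : Type*} [DecidableEq α] [AddCommMonoid M] (s : Finset α)
    (k : ℕ) (f : Finset α → α → M) :
    ∑ t ∈ s.powersetCard k, ∑ c ∈ s \ t, f t c
      = ∑ u ∈ s.powersetCard (k + 1), ∑ c ∈ u, f (u.erase c) c := by
  rw [sum_sigma', sum_sigma']
  refine sum_bij' (fun x _ => ⟨insert x.2 x.1, x.2⟩) (fun x _ => ⟨x.1.erase x.2, x.2⟩)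
    ?_ ?_ ?_ ?_ ?_
  · rintro ⟨t, c⟩ h
    simp only [mem_sigma, mem_powersetCard, mem_sdiff] at h ⊢
    obtain ⟨⟨ht, hk⟩, hc, hct⟩ := h
    exact ⟨⟨insert_subset hc ht, by rw [card_insert_of_notMem hct, hk]⟩, mem_insert_self _ _⟩
  · rintro ⟨u, c⟩ h
    simp only [mem_sigma, mem_powersetCard, mem_sdiff] at h ⊢
    obtain ⟨⟨hu, hk⟩, hc⟩ := h
    exact ⟨⟨(erase_subset _ _).trans hu, by rw [card_erase_of_mem hc, hk]; rfl⟩, hu hc,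
      notMem_erase _ _⟩
  · rintro ⟨t, c⟩ h
    simp only [mem_sigma, mem_sdiff] at h
    simp [h.2.2]
  · rintro ⟨u, c⟩ h
    simp only [mem_sigma] at h
    simp [h.2]
  · rintro ⟨t, c⟩ h
    simp only [mem_sigma, mem_sdiff] at h
    simp [h.2.2]

-- Ordered triples without repetition are sorted by how many of `p`, `q` they use: one of them can
-- occupy 3 positions, both can be placed in 6 ways.
open Finset in
theorem sum_insert_insert_of_symm {α : Type*} [DecidableEq α] {T : Finset α} {p q : α}
    (hp : p ∉ insert q T) (hq : q ∉ T) (g : α → α → α → ℤ) (h₁ : ∀ a b c, g b a c = g a b c)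
    (h₂ : ∀ a b c, g a c b = g a b c) (h₀ : ∀ a c, g a a c = 0) :
    ∑ a ∈ insert p (insert q T), ∑ b ∈ insert p (insert q T), ∑ c ∈ insert p (insert q T), g a b c
      = ∑ a ∈ T, ∑ b ∈ T, ∑ c ∈ T, g a b c + 3 * ∑ a ∈ T, ∑ b ∈ T, (g a b p + g a b q)
        + 6 * ∑ c ∈ T, g p q c := by
  have e₁ : ∀ x a b, g x a b = g a b x := fun x a b => by rw [h₁, h₂]
  have e₂ : ∀ x a b, g a x b = g a b x := fun x a b => by rw [h₂]
  have e₃ : ∀ x c, g x c c = 0 := fun x c => by rw [e₁, h₀]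
  have e₄ : ∀ x c, g c x c = 0 := fun x c => by rw [e₂, h₀]
  have e₅ : ∀ c, g p c q = g p q c := fun c => by rw [h₂]
  have e₆ : ∀ c, g c p q = g p q c := fun c => by rw [e₁]
  have e₇ : ∀ c, g q p c = g p q c := fun c => by rw [h₁]
  have e₈ : ∀ c, g q c p = g p q c := fun c => by rw [h₂, h₁]
  have e₉ : ∀ c, g c q p = g p q c := fun c => by rw [e₁, h₁]
  have s₁ : ∀ x, ∑ a ∈ T, ∑ b ∈ T, g x a b = ∑ a ∈ T, ∑ b ∈ T, g a b x := fun x => by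
    simp only [e₁ x]
  have s₂ : ∀ x, ∑ a ∈ T, ∑ b ∈ T, g a x b = ∑ a ∈ T, ∑ b ∈ T, g a b x := fun x => by
    simp only [e₂ x]
  simp only [sum_insert hp, sum_insert hq, sum_add_distrib, h₀, e₃, e₄, e₅, e₆, e₇, e₈, e₉, s₁, s₂,
    sum_const_zero]
  ring

open Finset in
theorem sum_three_cycle {α : Type*} (T : Finset α) (f : α → α → α → ℤ) :
    ∑ a ∈ T, ∑ b ∈ T, ∑ c ∈ T, f b c a = ∑ a ∈ T, ∑ b ∈ T, ∑ c ∈ T, f a b c := by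
  rw [sum_comm]
  refine sum_congr rfl fun a _ => ?_
  rw [sum_comm]

/-! ### Alternating circle sums for sets of odd size -/

/-- The sign `-1` for points inside the circle through `t`, and `1` for the others. -/
def circleSign (t : Finset Plane) (d : Plane) : ℤ :=
  open Classical in if InsideCircle t d then -1 else 1

theorem circleSign_eq {a b c d : Plane} (ho : orient a b c ≠ 0) (hi : inCircle a b c d ≠ 0) :
    circleSign {a, b, c} d = -(SignType.sign (orient a b c) : ℤ) * chi a b c d := by
  rw [chi, neg_mul, ← sign_cast_mul, circleSign]
  split_ifs with h
  · rw [sign_pos ((insideCircle_iff ho d).1 h)]; rfl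
  · have : orient a b c * inCircle a b c d < 0 :=
      lt_of_le_of_ne (not_lt.1 fun h' => h ((insideCircle_iff ho d).2 h')) (mul_ne_zero ho hi)
    rw [sign_neg this]; rfl

-- Each factor differs from `chi` by the same sign, which depends on the orientation of the triple.
-- An odd set leaves an even number of factors, so this sign cancels.
open Finset in
theorem prod_circleSign {P : Finset Plane} (hP : GeneralPosition P) (hodd : Odd P.card)
    {a b c : Plane} (ha : a ∈ P) (hb : b ∈ P) (hc : c ∈ P) (hab : a ≠ b) (hac : a ≠ c)
    (hbc : b ≠ c) :
    ∏ d ∈ P \ {a, b, c}, circleSign {a, b, c} d = ∏ d ∈ P \ {a, b, c}, chi a b c d := by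
  have ho := hP.orient_ne_zero ha hb hc hab hac hbc
  rw [prod_congr rfl (g := fun d => -(SignType.sign (orient a b c) : ℤ) * chi a b c d),
    prod_mul_distrib, prod_const]
  · have hsub : ({a, b, c} : Finset Plane) ⊆ P := by
      intro x; simp; rintro (rfl | rfl | rfl) <;> assumption
    have hcard : (P \ {a, b, c}).card + 3 = P.card := by
      rw [← card_eq_three.2 ⟨a, b, c, hab, hac, hbc, rfl⟩, card_sdiff_add_card_eq_card hsub]
    have heven : Even (P \ {a, b, c}).card := by
      rw [← hcard] at hodd
      by_contra h
      exact Nat.not_even_iff_odd.2 hodd ((Nat.not_even_iff_odd.1 h).add_odd (by decide))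
    obtain ⟨k, hk⟩ := heven
    rw [hk, ← two_mul, pow_mul, neg_sq, sq, sign_cast_mul_self ho, one_pow, one_mul]
  · intro d hd
    simp only [mem_sdiff, mem_insert, mem_singleton, not_or] at hd
    exact circleSign_eq ho (hP.inCircle_ne_zero ha hb hc hd.1 hab hac hbc (Ne.symm hd.2.1)
      (Ne.symm hd.2.2.1) (Ne.symm hd.2.2.2))

/-- The power of `c` with respect to the circle with diameter `pq`. -/
def diamPower (p q c : Plane) : ℝ := (c 0 - p 0) * (c 0 - q 0) + (c 1 - p 1) * (c 1 - q 1)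

theorem sign_cast_cases {x : ℝ} (h : x ≠ 0) :
    (SignType.sign x : ℤ) = 1 ∧ 0 < x ∨ (SignType.sign x : ℤ) = -1 ∧ x < 0 := by
  rcases lt_or_gt_of_ne h with h | h
  · right; simp [sign_neg h, h]
  · left; simp [sign_pos h, h]

/-- Only opposite signs of `x` and `y` need an argument: then the claim is that exactly one of `u`,
`v`, `w` is positive if `x > 0`, and exactly two if `x < 0`. The relation `h₀` forbids three equal
signs, and the other three relations forbid the wrong majority. -/
theorem sign_relation {x y u v w : ℝ} (hx : x ≠ 0) (hy : y ≠ 0) (hu : u ≠ 0) (hv : v ≠ 0)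
    (hw : w ≠ 0) (h₀ : ∃ k > 0, ∃ l > 0, ∃ m > 0, u * k + v * l + w * m = 0)
    (hru : ∃ k > 0, ∃ l > 0, ∃ m > 0, ∃ n > 0, u * k + v * l - y * m + x * n = 0)
    (hrv : ∃ k > 0, ∃ l > 0, ∃ m > 0, ∃ n > 0, v * k + w * l - y * m + x * n = 0)
    (hrw : ∃ k > 0, ∃ l > 0, ∃ m > 0, ∃ n > 0, w * k + u * l - y * m + x * n = 0) :
    (SignType.sign x : ℤ) * SignType.sign y + (SignType.sign y - SignType.sign x) *
      (SignType.sign u + SignType.sign v + SignType.sign w) = 1 := by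
  obtain ⟨k₀, hk₀, l₀, hl₀, m₀, hm₀, e₀⟩ := h₀
  obtain ⟨k₁, hk₁, l₁, hl₁, m₁, hm₁, n₁, hn₁, e₁⟩ := hru
  obtain ⟨k₂, hk₂, l₂, hl₂, m₂, hm₂, n₂, hn₂, e₂⟩ := hrv
  obtain ⟨k₃, hk₃, l₃, hl₃, m₃, hm₃, n₃, hn₃, e₃⟩ := hrw
  rcases sign_cast_cases hx with ⟨sx, hx⟩ | ⟨sx, hx⟩ <;>
  rcases sign_cast_cases hy with ⟨sy, hy⟩ | ⟨sy, hy⟩ <;> rw [sx, sy] <;> try norm_num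
  all_goals
    rcases sign_cast_cases hu with ⟨su, hu⟩ | ⟨su, hu⟩ <;>
    rcases sign_cast_cases hv with ⟨sv, hv⟩ | ⟨sv, hv⟩ <;>
    rcases sign_cast_cases hw with ⟨sw, hw⟩ | ⟨sw, hw⟩ <;> rw [su, sv, sw] <;> norm_num
  all_goals
    exfalso
    first
    | nlinarith [mul_pos hu hk₀, mul_pos hv hl₀, mul_pos hw hm₀]
    | nlinarith [mul_neg_of_neg_of_pos hu hk₀, mul_neg_of_neg_of_pos hv hl₀,
        mul_neg_of_neg_of_pos hw hm₀]
    | linarith [mul_pos hu hk₁, mul_pos hv hl₁, mul_neg_of_neg_of_pos hy hm₁, mul_pos hx hn₁]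
    | linarith [mul_pos hv hk₂, mul_pos hw hl₂, mul_neg_of_neg_of_pos hy hm₂, mul_pos hx hn₂]
    | linarith [mul_pos hw hk₃, mul_pos hu hl₃, mul_neg_of_neg_of_pos hy hm₃, mul_pos hx hn₃]
    | linarith [mul_neg_of_neg_of_pos hu hk₁, mul_neg_of_neg_of_pos hv hl₁, mul_pos hy hm₁,
        mul_neg_of_neg_of_pos hx hn₁]
    | linarith [mul_neg_of_neg_of_pos hv hk₂, mul_neg_of_neg_of_pos hw hl₂, mul_pos hy hm₂,
        mul_neg_of_neg_of_pos hx hn₂]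
    | linarith [mul_neg_of_neg_of_pos hw hk₃, mul_neg_of_neg_of_pos hu hl₃, mul_pos hy hm₃,
        mul_neg_of_neg_of_pos hx hn₃]

/-- The lifts of five points satisfy a linear relation with in-circle determinants as coefficients,
to which any circle power can be applied. The circle with diameter `pq` has power zero at `p` and
`q`, so three terms remain. -/
theorem diamPower_relation (a b c p q : Plane) :
    inCircle a b p q * diamPower p q c + inCircle b c p q * diamPower p q a
      + inCircle c a p q * diamPower p q b = 0 := by
  simp only [inCircle, orient, sqDist, diamPower, PiLp.zero_apply]; ring

/-- The same dependence evaluated at the squared distance to `e`. Choosing `e` among `a`, `b`, `c`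
kills one term and leaves positive weights on the others. -/
theorem sqDist_relation (a b c p q e : Plane) :
    inCircle a b p q * sqDist c e + inCircle b c p q * sqDist a e + inCircle c a p q * sqDist b e
      - inCircle a b c q * sqDist p e + inCircle a b c p * sqDist q e = 0 := by
  simp only [inCircle, orient, sqDist, PiLp.zero_apply]; ring

theorem chi_relation {P : Finset Plane} (hP : GeneralPosition P) {a b c p q : Plane}
    (ha : a ∈ P) (hb : b ∈ P) (hc : c ∈ P) (hp : p ∈ P) (hq : q ∈ P) (hab : a ≠ b) (hac : a ≠ c)
    (hbc : b ≠ c) (hap : a ≠ p) (hbp : b ≠ p) (hcp : c ≠ p) (haq : a ≠ q) (hbq : b ≠ q)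
    (hcq : c ≠ q) (hpq : p ≠ q) (da : 0 < diamPower p q a) (db : 0 < diamPower p q b)
    (dc : 0 < diamPower p q c) :
    chi a b c p * chi a b c q + (chi a b c q - chi a b c p) *
      (chi a b p q + chi b c p q + chi c a p q) = 1 := by
  refine sign_relation (hP.inCircle_ne_zero ha hb hc hp hab hac hbc hap hbp hcp)
    (hP.inCircle_ne_zero ha hb hc hq hab hac hbc haq hbq hcq)
    (hP.inCircle_ne_zero ha hb hp hq hab hap hbp haq hbq hpq)
    (hP.inCircle_ne_zero hb hc hp hq hbc hbp hcp hbq hcq hpq)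
    (hP.inCircle_ne_zero hc ha hp hq hac.symm hcp hap hcq haq hpq)
    ⟨_, dc, _, da, _, db, diamPower_relation a b c p q⟩ ?_ ?_ ?_
  · refine ⟨_, sqDist_pos hbc.symm, _, sqDist_pos hab, _, sqDist_pos hbp.symm, _,
      sqDist_pos hbq.symm, ?_⟩
    linear_combination sqDist_relation a b c p q b - inCircle c a p q * sqDist_self b
  · refine ⟨_, sqDist_pos hac, _, sqDist_pos hbc, _, sqDist_pos hcp.symm, _,
      sqDist_pos hcq.symm, ?_⟩
    linear_combination sqDist_relation a b c p q c - inCircle a b p q * sqDist_self c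
  · refine ⟨_, sqDist_pos hab.symm, _, sqDist_pos hac.symm, _, sqDist_pos hap.symm, _,
      sqDist_pos haq.symm, ?_⟩
    linear_combination sqDist_relation a b c p q a - inCircle b c p q * sqDist_self a

open Finset in
theorem insert_insert_sdiff_triple {α : Type*} [DecidableEq α] {T : Finset α} {p q a b c : α}
    (hpT : p ∉ T) (hqT : q ∉ T) (ha : a ∈ T) (hb : b ∈ T) (hc : c ∈ T) :
    insert p (insert q T) \ {a, b, c} = insert p (insert q (T \ {a, b, c})) := by
  ext x; simp; grind

open Finset in
theorem insert_insert_sdiff_left {α : Type*} [DecidableEq α] {T : Finset α} {p q a b : α}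
    (hpq : p ≠ q) (hpT : p ∉ T) (hqT : q ∉ T) (ha : a ∈ T) (hb : b ∈ T) :
    insert p (insert q T) \ {a, b, p} = insert q (T \ {a, b}) := by
  ext x; simp; grind

open Finset in
theorem insert_insert_sdiff_right {α : Type*} [DecidableEq α] {T : Finset α} {p q a b : α}
    (hpq : p ≠ q) (hpT : p ∉ T) (hqT : q ∉ T) (ha : a ∈ T) (hb : b ∈ T) :
    insert p (insert q T) \ {a, b, q} = insert p (T \ {a, b}) := by
  ext x; simp; grind

open Finset in
theorem insert_insert_sdiff_both {α : Type*} [DecidableEq α] {T : Finset α} {p q : α}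
    (hpT : p ∉ T) (hqT : q ∉ T) (c : α) :
    insert p (insert q T) \ {p, q, c} = T.erase c := by
  ext x; simp; grind

-- Adding `r` to `T \ {a, b}` gives an even set, so `sum_prod_sign_eq_zero` applies to the form
-- `inCircle a b`; the term of `r` is isolated. This trades a triple with one outside point for
-- triples within `T`.
open Finset in
theorem pencil_relation {P T : Finset Plane} (hP : GeneralPosition P) (hTP : T ⊆ P)
    (hodd : Odd T.card) {a b r : Plane} (ha : a ∈ T) (hb : b ∈ T) (hab : a ≠ b) (hr : r ∈ P)
    (hrT : r ∉ T) :
    ∏ d ∈ T \ {a, b}, chi a b r d = -∑ c ∈ T, chi a b c r *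
      (if a ≠ b ∧ a ≠ c ∧ b ≠ c then ∏ d ∈ T \ {a, b, c}, chi a b c d else 0) := by
  have hsub : ({a, b} : Finset Plane) ⊆ T := by
    intro x; simp; rintro (rfl | rfl) <;> assumption
  have hr' : r ∉ T \ {a, b} := fun h => hrT (mem_sdiff.1 h).1
  have hcard : (T \ {a, b}).card + 2 = T.card := by
    have := card_sdiff_add_card_eq_card hsub
    rwa [card_pair hab] at this
  have heven : Even (insert r (T \ {a, b})).card := by
    rw [card_insert_of_notMem hr']
    rw [← hcard] at hodd
    rw [Nat.even_iff]
    rw [Nat.odd_iff] at hodd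
    omega
  have hmem : ∀ c ∈ insert r (T \ {a, b}), c ∈ P ∧ a ≠ c ∧ b ≠ c := fun c hc => by
    simp only [mem_insert, mem_sdiff, mem_singleton, not_or] at hc
    rcases hc with rfl | ⟨h1, h2, h3⟩
    · exact ⟨hr, fun h => hrT (h ▸ ha), fun h => hrT (h ▸ hb)⟩
    · exact ⟨hTP h1, Ne.symm h2, Ne.symm h3⟩
  have key := sum_prod_sign_eq_zero heven (D := inCircle a b)
    (fun c d => by simp only [inCircle, orient]; ring) (inCircle_plucker a b)
    (fun c hc d hd hcd => by
      obtain ⟨h1, h2, h3⟩ := hmem c hc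
      obtain ⟨h4, h5, h6⟩ := hmem d hd
      exact hP.inCircle_ne_zero (hTP ha) (hTP hb) h1 h4 hab h2 h3 h5 h6 hcd)
  rw [sum_insert hr', erase_insert hr'] at key
  rw [eq_neg_iff_add_eq_zero]
  refine Eq.trans ?_ key
  refine congrArg₂ _ rfl ?_
  refine Eq.trans (sum_subset (sdiff_subset (t := {a, b})) ?_).symm (sum_congr rfl ?_)
  · intro c hc hc'
    have : ¬ (a ≠ b ∧ a ≠ c ∧ b ≠ c) := by
      rintro ⟨-, h1, h2⟩
      exact hc' (by simp [hc, Ne.symm h1, Ne.symm h2])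
    rw [if_neg this, mul_zero]
  · intro c hc
    have hcr : r ≠ c := fun h => hr' (h ▸ hc)
    obtain ⟨-, h1, h2⟩ := hmem c (mem_insert_of_mem hc)
    have he : (T \ {a, b}).erase c = T \ {a, b, c} := by ext x; simp; tauto
    rw [if_pos ⟨hab, h1, h2⟩, erase_insert_of_ne hcr, prod_insert, he]
    · rfl
    · exact fun h => hr' (mem_of_mem_erase h)

/-- The pencil of circles through `p` and `q` is spanned by the circle with diameter `pq` and the
line `pq`. -/
theorem inCircle_eq_diamPower (p q c d : Plane) :
    inCircle p q c d = diamPower p q c * orient p q d - diamPower p q d * orient p q c := by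
  simp only [inCircle, orient, sqDist, diamPower, PiLp.zero_apply]; ring

-- With every power positive, the ratio of `orient p q` to the power orders the points along the
-- pencil, and all signs of `x` in `sum_sign_mul_prod_sign` are `1`.
open Finset in
theorem sum_prod_chi_eq_one {P T : Finset Plane} (hP : GeneralPosition P) (hTP : T ⊆ P)
    (hodd : Odd T.card) {p q : Plane} (hp : p ∈ P) (hq : q ∈ P) (hpT : p ∉ T) (hqT : q ∉ T)
    (hpq : p ≠ q) (hd : ∀ c ∈ T, 0 < diamPower p q c) :
    ∑ c ∈ T, ∏ d ∈ T.erase c, chi p q c d = 1 := by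
  have key := sum_sign_mul_prod_sign hodd (D := inCircle p q) (x := diamPower p q)
    (t := fun c => orient p q c / diamPower p q c) (fun c hc => (hd c hc).ne')
    (fun c hc d hd' => by
      have h1 := (hd c hc).ne'
      have h2 := (hd d hd').ne'
      rw [inCircle_eq_diamPower]
      field_simp)
    (fun c hc d hd hcd => hP.inCircle_ne_zero hp hq (hTP hc) (hTP hd) hpq
      (fun h => hpT (h ▸ hc)) (fun h => hqT (h ▸ hc)) (fun h => hpT (h ▸ hd))
      (fun h => hqT (h ▸ hd)) hcd)
  rw [prod_congr rfl (g := fun _ => (1 : ℤ)) fun c hc => by rw [sign_pos (hd c hc)]; rfl,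
    prod_const_one] at key
  rw [← key]
  refine sum_congr rfl fun c hc => ?_
  rw [sign_pos (hd c hc)]
  simp [chi]

open Finset in
/-- Removing a pair spanning an empty diametral circle decreases the alternating circle sum by a
constant. -/
theorem ordered_circle_sum_step {T : Finset Plane} {p q : Plane}
    (hP : GeneralPosition (insert p (insert q T))) (hodd : Odd T.card) (hpT : p ∉ T) (hqT : q ∉ T)
    (hpq : p ≠ q) (hd : ∀ c ∈ T, 0 < diamPower p q c) :
    ∑ t ∈ (insert p (insert q T)).powersetCard 3,
        ∏ d ∈ insert p (insert q T) \ t, circleSign t d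
      = ∑ t ∈ T.powersetCard 3, ∏ d ∈ T \ t, circleSign t d + 1 := by
  set P := insert p (insert q T) with hPdef
  have hTP : T ⊆ P := fun x hx => by simp [P, hx]
  have hp : p ∈ P := by simp [P]
  have hq : q ∈ P := by simp [P]
  have hne : ∀ c ∈ T, c ≠ p ∧ c ≠ q := fun c hc =>
    ⟨fun h => hpT (h ▸ hc), fun h => hqT (h ▸ hc)⟩
  have hPodd : Odd P.card := by
    rw [card_insert_of_notMem (by simp [hpq, hpT]), card_insert_of_notMem hqT]
    rw [Nat.odd_iff] at hodd ⊢
    omega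
  -- `W` is the sign of an ordered triple within `P`, and `G` its sign within `T`. Ordered triples
  -- allow the cyclic relabeling used below.
  set W : Plane → Plane → Plane → ℤ := fun a b c =>
    if a ≠ b ∧ a ≠ c ∧ b ≠ c then ∏ d ∈ P \ {a, b, c}, circleSign {a, b, c} d else 0 with hW
  set G : Plane → Plane → Plane → ℤ := fun a b c =>
    if a ≠ b ∧ a ≠ c ∧ b ≠ c then ∏ d ∈ T \ {a, b, c}, chi a b c d else 0 with hG
  have hGcyc : ∀ a b c, G b c a = G a b c := fun a b c => by
    have h1 : ({b, c, a} : Finset Plane) = {a, b, c} := by ext x; simp; tauto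
    have h2 : ∀ d, chi b c a d = chi a b c d := fun d => by
      rw [chi_swap_middle, chi_swap_left, neg_neg]
    simp only [hG, h1, h2]
    refine if_congr ?_ rfl rfl
    tauto
  have hWT : ∀ a ∈ T, ∀ b ∈ T, ∀ c ∈ T,
      W a b c = G a b c * (chi a b c p * chi a b c q) := by
    intro a ha b hb c hc
    simp only [hW, hG]
    split_ifs with h
    · rw [prod_circleSign hP hPodd (hTP ha) (hTP hb) (hTP hc) h.1 h.2.1 h.2.2]
      rw [insert_insert_sdiff_triple hpT hqT ha hb hc, prod_insert (by simp [hpq, hpT]), prod_insert (by simp [hqT])]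
      ring
    · simp
  have hWp : ∀ a ∈ T, ∀ b ∈ T,
      W a b p = -∑ c ∈ T, chi a b p q * chi a b c p * G a b c := by
    intro a ha b hb
    by_cases hab : a = b
    · simp [hW, hG, hab]
    have h1 := hne a ha
    have h2 := hne b hb
    simp only [mul_assoc, ← mul_sum]
    simp only [hW]
    rw [if_pos ⟨hab, h1.1, h2.1⟩, prod_circleSign hP hPodd (hTP ha) (hTP hb) hp hab h1.1 h2.1,
      insert_insert_sdiff_left hpq hpT hqT ha hb, prod_insert (by simp [hqT]), pencil_relation hP hTP hodd ha hb hab hp hpT, mul_neg]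
  have hWq : ∀ a ∈ T, ∀ b ∈ T,
      W a b q = ∑ c ∈ T, chi a b p q * chi a b c q * G a b c := by
    intro a ha b hb
    by_cases hab : a = b
    · simp [hW, hG, hab]
    have h1 := hne a ha
    have h2 := hne b hb
    simp only [mul_assoc, ← mul_sum]
    simp only [hW]
    rw [if_pos ⟨hab, h1.2, h2.2⟩, prod_circleSign hP hPodd (hTP ha) (hTP hb) hq hab h1.2 h2.2,
      insert_insert_sdiff_right hpq hpT hqT ha hb, prod_insert (by simp [hpT]), pencil_relation hP hTP hodd ha hb hab hq hqT,
      chi_swap_right, neg_mul_neg]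
  have hM : ∑ c ∈ T, W p q c = 1 := by
    rw [← sum_prod_chi_eq_one hP hTP hodd hp hq hpT hqT hpq hd]
    refine sum_congr rfl fun c hc => ?_
    have h1 := hne c hc
    simp only [hW]
    rw [if_pos ⟨hpq, h1.1.symm, h1.2.symm⟩,
      prod_circleSign hP hPodd hp hq (hTP hc) hpq h1.1.symm h1.2.symm,
      insert_insert_sdiff_both hpT hqT]
  have hT : 6 * ∑ t ∈ T.powersetCard 3, ∏ d ∈ T \ t, circleSign t d
      = ∑ a ∈ T, ∑ b ∈ T, ∑ c ∈ T, G a b c := by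
    rw [six_mul_sum_powersetCard_three]
    refine sum_congr rfl fun a ha => sum_congr rfl fun b hb => sum_congr rfl fun c hc => ?_
    simp only [hG]
    split_ifs with h
    · exact prod_circleSign (hP.mono hTP) hodd ha hb hc h.1 h.2.1 h.2.2
    · rfl
  have hexp := sum_insert_insert_of_symm (T := T) (p := p) (q := q) (by simp [hpq, hpT]) hqT W
    (fun a b c => by
      have h1 : ({b, a, c} : Finset Plane) = {a, b, c} := by ext x; simp; tauto
      simp only [hW, h1]
      exact if_congr (by tauto) rfl rfl)
    (fun a b c => by
      have h1 : ({a, c, b} : Finset Plane) = {a, b, c} := by ext x; simp; tauto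
      simp only [hW, h1]
      exact if_congr (by tauto) rfl rfl)
    (fun a c => by simp [hW])
  have hpair : ∑ a ∈ T, ∑ b ∈ T, (W a b p + W a b q)
      = ∑ a ∈ T, ∑ b ∈ T, ∑ c ∈ T, chi a b p q * ((chi a b c q - chi a b c p) * G a b c) := by
    refine sum_congr rfl fun a ha => sum_congr rfl fun b hb => ?_
    rw [hWp a ha b hb, hWq a ha b hb, ← sum_neg_distrib, ← sum_add_distrib]
    exact sum_congr rfl fun c _ => by ring
  set f : Plane → Plane → Plane → ℤ := fun a b c =>
    chi a b p q * ((chi a b c q - chi a b c p) * G a b c) with hf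
  have hcyc : ∀ a b c d, chi b c a d = chi a b c d := fun a b c d => by
    rw [chi_swap_middle, chi_swap_left, neg_neg]
  have hfb : ∀ a b c, f b c a = chi b c p q * ((chi a b c q - chi a b c p) * G a b c) :=
    fun a b c => by simp only [hf, hcyc a b c, hGcyc a b c]
  have hfc : ∀ a b c, f c a b = chi c a p q * ((chi a b c q - chi a b c p) * G a b c) :=
    fun a b c => by
      simp only [hf]
      rw [← hcyc c a b q, ← hcyc c a b p, ← hGcyc c a b]
  -- The factor multiplying `chi a b p q` in `f` is invariant under cyclic shifts, so averaging
  -- produces the sum of three signs in `chi_relation`.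
  have h3 : 3 * ∑ a ∈ T, ∑ b ∈ T, ∑ c ∈ T, f a b c
      = ∑ a ∈ T, ∑ b ∈ T, ∑ c ∈ T, (f a b c + f b c a + f c a b) := by
    simp only [sum_add_distrib]
    rw [sum_three_cycle T f, sum_three_cycle T fun a b c => f b c a, sum_three_cycle T f]
    ring
  have hsum : ∑ a ∈ T, ∑ b ∈ T, ∑ c ∈ T, W a b c + 3 * ∑ a ∈ T, ∑ b ∈ T, ∑ c ∈ T, f a b c
      = ∑ a ∈ T, ∑ b ∈ T, ∑ c ∈ T, G a b c := by
    rw [h3]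
    simp only [← sum_add_distrib]
    refine sum_congr rfl fun a ha => sum_congr rfl fun b hb => sum_congr rfl fun c hc => ?_
    rw [hWT a ha b hb c hc, hfb a b c, hfc a b c]
    by_cases h : a ≠ b ∧ a ≠ c ∧ b ≠ c
    · have hrel := chi_relation hP (hTP ha) (hTP hb) (hTP hc) hp hq h.1 h.2.1 h.2.2
        (hne a ha).1 (hne b hb).1 (hne c hc).1 (hne a ha).2 (hne b hb).2 (hne c hc).2 hpq
        (hd a ha) (hd b hb) (hd c hc)
      linear_combination G a b c * hrel
    · have hG0 : G a b c = 0 := if_neg h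
      simp [hf, hG0]
  have hPsum := six_mul_sum_powersetCard_three P fun t => ∏ d ∈ P \ t, circleSign t d
  rw [hpair, hM] at hexp
  linarith

open Finset in
/-- The alternating sum over the circles through three points of a set of odd size, signed by the
number of points inside, only depends on the number of points. -/
theorem sum_prod_circleSign_of_card_odd (m : ℕ) : ∀ P : Finset Plane, GeneralPosition P →
    P.card = 2 * m + 1 →
    ∑ t ∈ P.powersetCard 3, ∏ d ∈ P \ t, circleSign t d = m := by
  induction m with
  | zero =>
    intro P _ hcard
    rw [powersetCard_eq_empty.2 (by omega)]
    simp
  | succ m ih =>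
    intro P hP hcard
    obtain ⟨q, hq⟩ : P.Nonempty := card_pos.1 (by omega)
    have hqcard := card_erase_add_one hq
    -- A nearest neighbor `p` of `q` makes the circle with diameter `pq` empty: any other `c` has
    -- `|cp|² + |cq|² > |pq|²`.
    obtain ⟨p, hp, hmin⟩ := exists_min_image (P.erase q) (fun x => sqDist x q)
      (card_pos.1 (by omega))
    have hpcard := card_erase_add_one hp
    have hPeq : P = insert p (insert q ((P.erase q).erase p)) := by
      rw [insert_comm, insert_erase hp, insert_erase hq]
    set T := (P.erase q).erase p with hT
    have hpT : p ∉ T := notMem_erase _ _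
    have hqT : q ∉ T := fun h => notMem_erase q P (mem_of_mem_erase h)
    have hTcard : T.card = 2 * m + 1 := by omega
    have hpq : p ≠ q := ne_of_mem_erase hp
    have hTP : T ⊆ P := (erase_subset _ _).trans (erase_subset _ _)
    have hstep := ordered_circle_sum_step (hPeq ▸ hP) ⟨m, hTcard⟩ hpT hqT hpq fun c hc => by
      have h1 := hmin c (mem_of_mem_erase hc)
      have h2 := sqDist_pos (ne_of_mem_erase hc)
      have h3 : 2 * diamPower p q c = sqDist c p + sqDist c q - sqDist p q := by
        simp only [diamPower, sqDist]; ring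
      linarith
    rw [← hPeq, ih T (hP.mono hTP) hTcard] at hstep
    rw [hstep]
    push_cast
    ring

/-! ### Second moment and alternating sum of the inside counts -/

/-- The number of points of `S` inside the circle through `t`. -/
def insideCount (S t : Finset Plane) : ℕ :=
  open Classical in ((S \ t).filter (InsideCircle t)).card

theorem prod_circleSign_eq_neg_one_pow (S t : Finset Plane) :
    ∏ d ∈ S \ t, circleSign t d = (-1) ^ insideCount S t := by
  classical
  simp only [circleSign]
  rw [Finset.prod_ite]
  simp [insideCount]

theorem insideCount_eq_sum (S t : Finset Plane) :
    (insideCount S t : ℤ) = ∑ d ∈ S \ t, open Classical in if InsideCircle t d then 1 else 0 := by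
  classical
  rw [Finset.sum_ite]
  simp [insideCount]

theorem sum_circleSign (S t : Finset Plane) :
    ∑ d ∈ S \ t, circleSign t d = (S \ t).card - 2 * insideCount S t := by
  classical
  rw [insideCount_eq_sum, Finset.mul_sum, Finset.card_eq_sum_ones]
  push_cast
  rw [← Finset.sum_sub_distrib]
  refine Finset.sum_congr rfl fun d _ => ?_
  unfold circleSign
  split_ifs <;> norm_num

open Finset in
theorem two_mul_sum_powersetCard_two_prod {α : Type*} [DecidableEq α] (s : Finset α) (f : α → ℤ) :
    2 * ∑ u ∈ s.powersetCard 2, ∏ d ∈ u, f d = (∑ a ∈ s, f a) ^ 2 - ∑ a ∈ s, f a ^ 2 := by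
  rw [two_mul_sum_powersetCard_two, sq, sum_mul_sum, ← sum_sub_distrib]
  refine sum_congr rfl fun a ha => ?_
  rw [← add_sum_erase s (fun b => f a * f b) ha, sum_ite, ← sq, add_sub_cancel_left]
  simp only [sum_const_zero, add_zero]
  refine sum_congr (by ext x; simp; tauto) fun b hb => ?_
  rw [prod_pair (ne_of_mem_erase hb).symm]

open Finset in
/-- The second moment of the number of points inside a circle through three of the points. -/
theorem sum_sq_insideCount {S : Finset Plane} (hS : GeneralPosition S) :
    ∑ t ∈ S.powersetCard 3,
      (((S.card : ℤ) - 3 - 2 * insideCount S t) ^ 2 - ((S.card : ℤ) - 3))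
      = 4 * (S.card.choose 5 : ℤ) := by
  -- Each five-point subset contributes `2`. Regrouped as a triple plus a pair, the pairs give the
  -- second elementary symmetric function of the `n - 3` signs, whose sum is `n - 3 - 2c`.
  have h := sum_powersetCard_sdiff S 3 2 fun t v => ∏ d ∈ v, circleSign t d
  rw [sum_congr rfl (g := fun _ => (2 : ℤ)) fun u hu => by
    obtain ⟨hu, hc⟩ := mem_powersetCard.1 hu
    exact_mod_cast sum_prod_circleSign_of_card_odd 2 u (hS.mono hu) hc] at h
  rw [sum_const, card_powersetCard, nsmul_eq_mul] at h
  have h2 : (4 : ℤ) * S.card.choose 5 = ∑ t ∈ S.powersetCard 3,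
      2 * ∑ v ∈ (S \ t).powersetCard 2, ∏ d ∈ v, circleSign t d := by
    rw [← mul_sum, ← h]; ring
  rw [h2]
  refine sum_congr rfl fun t ht => ?_
  obtain ⟨ht, hc⟩ := mem_powersetCard.1 ht
  have hcard : ((S \ t).card : ℤ) = S.card - 3 := by
    have := card_sdiff_add_card_eq_card ht
    rw [hc] at this
    omega
  rw [two_mul_sum_powersetCard_two_prod, sum_circleSign, hcard]
  congr 1
  rw [← hcard, sum_congr rfl (g := fun _ => (1 : ℤ)) fun d _ => by
    unfold circleSign; split_ifs <;> norm_num]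
  simp

open Finset in
/-- The alternating sum of the number of circles containing a given number of points. -/
theorem sum_neg_one_pow_insideCount {S : Finset Plane} (hS : GeneralPosition S)
    (hodd : Odd S.card) :
    2 * ∑ t ∈ S.powersetCard 3, (-1 : ℤ) ^ insideCount S t = S.card - 1 := by
  obtain ⟨m, hm⟩ := hodd
  have := sum_prod_circleSign_of_card_odd m S hS hm
  simp only [prod_circleSign_eq_neg_one_pow] at this
  rw [this, hm]
  push_cast
  ring

/-! ### Four points, crossings and the first moment -/

/-- The zero sum forbids four equal signs. In a 3–1 split `I` takes the majority sign, so one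
product is negative; in a 2–2 split two are, whatever the sign of `I`. -/
theorem four_sign {u v w x I : ℝ} (hu : u ≠ 0) (hv : v ≠ 0) (hw : w ≠ 0) (hx : x ≠ 0) (hI : I ≠ 0)
    (hsum : u + v + w + x = 0)
    (hIu : ∃ k > 0, ∃ l > 0, ∃ m > 0, I = v * k + w * l + x * m)
    (hIv : ∃ k > 0, ∃ l > 0, ∃ m > 0, I = u * k + w * l + x * m)
    (hIw : ∃ k > 0, ∃ l > 0, ∃ m > 0, I = u * k + v * l + x * m)
    (hIx : ∃ k > 0, ∃ l > 0, ∃ m > 0, I = u * k + v * l + w * m) :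
    (if u * I < 0 then 1 else 0) + (if v * I < 0 then 1 else 0) + (if w * I < 0 then 1 else 0)
      + (if x * I < 0 then 1 else 0) = (1 : ℤ) + if (0 < u * v ∧ 0 < w * x) ∨
        (0 < u * w ∧ 0 < v * x) ∨ (0 < u * x ∧ 0 < v * w) then 1 else 0 := by
  obtain ⟨k₀, hk₀, l₀, hl₀, m₀, hm₀, e₀⟩ := hIu
  obtain ⟨k₁, hk₁, l₁, hl₁, m₁, hm₁, e₁⟩ := hIv
  obtain ⟨k₂, hk₂, l₂, hl₂, m₂, hm₂, e₂⟩ := hIw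
  obtain ⟨k₃, hk₃, l₃, hl₃, m₃, hm₃, e₃⟩ := hIx
  have pp {a b : ℝ} (ha : 0 < a) (hb : 0 < b) : 0 < a * b := mul_pos ha hb
  have np {a b : ℝ} (ha : a < 0) (hb : 0 < b) : a * b < 0 := mul_neg_of_neg_of_pos ha hb
  rcases lt_or_gt_of_ne hu with hu | hu <;> rcases lt_or_gt_of_ne hv with hv | hv <;>
  rcases lt_or_gt_of_ne hw with hw | hw <;> rcases lt_or_gt_of_ne hx with hx | hx <;>
  rcases lt_or_gt_of_ne hI with hI | hI <;>
  first
  | (exfalso; linarith)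
  | (simp [mul_neg_iff, mul_pos_iff, hu, hv, hw, hx, hI, hu.not_gt, hv.not_gt, hw.not_gt,
      hx.not_gt, hI.not_gt]; done)
  | (exfalso; linarith [pp hv hk₀, pp hw hl₀, pp hx hm₀])
  | (exfalso; linarith [np hv hk₀, np hw hl₀, np hx hm₀])
  | (exfalso; linarith [pp hu hk₁, pp hw hl₁, pp hx hm₁])
  | (exfalso; linarith [np hu hk₁, np hw hl₁, np hx hm₁])
  | (exfalso; linarith [pp hu hk₂, pp hv hl₂, pp hx hm₂])
  | (exfalso; linarith [np hu hk₂, np hv hl₂, np hx hm₂])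
  | (exfalso; linarith [pp hu hk₃, pp hv hl₃, pp hw hm₃])
  | (exfalso; linarith [np hu hk₃, np hv hl₃, np hw hm₃])

/-- The open segments `ab` and `cd` meet. -/
def SegmentsCross (a b c d : Plane) : Prop :=
  (openSegment ℝ a b ∩ openSegment ℝ c d).Nonempty

theorem SegmentsCross.exists_weights {a b c d : Plane} (h : SegmentsCross a b c d) :
    ∃ u > 0, ∃ v > 0, u * orient a b c + v * orient a b d = 0 := by
  obtain ⟨x, ⟨s, t, hs, ht, hst, rfl⟩, ⟨u, v, hu, hv, huv, hx⟩⟩ := h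
  refine ⟨u, hu, v, hv, ?_⟩
  have h0 := congrArg (fun p : Plane => p 0) hx
  have h1 := congrArg (fun p : Plane => p 1) hx
  simp at h0 h1
  obtain rfl : u = 1 - v := by linarith
  obtain rfl : s = 1 - t := by linarith
  simp only [orient]
  linear_combination (b 0 - a 0) * h1 - (b 1 - a 1) * h0

theorem SegmentsCross.symm {a b c d : Plane} (h : SegmentsCross a b c d) :
    SegmentsCross c d a b := by
  rwa [SegmentsCross, Set.inter_comm]

theorem segmentsCross_swap_left {a b c d : Plane} :
    SegmentsCross b a c d ↔ SegmentsCross a b c d := by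
  rw [SegmentsCross, openSegment_symm, SegmentsCross]

theorem segmentsCross_swap_right {a b c d : Plane} :
    SegmentsCross a b d c ↔ SegmentsCross a b c d := by
  rw [SegmentsCross, openSegment_symm ℝ d c, SegmentsCross]

theorem segmentsCross_comm {a b c d : Plane} :
    SegmentsCross c d a b ↔ SegmentsCross a b c d := ⟨.symm, .symm⟩

theorem mul_neg_of_weights {x y : ℝ} (hx : x ≠ 0)
    (h : ∃ u > 0, ∃ v > 0, u * x + v * y = 0) : x * y < 0 := by
  obtain ⟨u, hu, v, hv, h⟩ := h
  have : v * (x * y) = -(u * x ^ 2) := by linear_combination x * h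
  have h2 : 0 < u * x ^ 2 := by positivity
  by_contra hn
  have := mul_nonneg hv.le (not_lt.1 hn)
  linarith

theorem segmentsCross_iff {a b c d : Plane} (h₁ : orient a b c ≠ 0) (h₂ : orient a c d ≠ 0) :
    SegmentsCross a b c d ↔
      orient a b c * orient a b d < 0 ∧ orient a c d * orient b c d < 0 := by
  have e₁ : orient c d a = orient a c d := by simp only [orient]; ring
  have e₂ : orient c d b = orient b c d := by simp only [orient]; ring
  constructor
  · intro h
    refine ⟨mul_neg_of_weights h₁ h.exists_weights, ?_⟩
    have := h.symm.exists_weights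
    rw [e₁, e₂] at this
    exact mul_neg_of_weights h₂ this
  · rintro ⟨h, h'⟩
    have key {x y : ℝ} (h : x * y < 0) : 0 < x / (x - y) ∧ 0 < -y / (x - y) ∧ x - y ≠ 0 := by
      rcases mul_neg_iff.1 h with ⟨hx, hy⟩ | ⟨hx, hy⟩
      · have : 0 < x - y := by linarith
        exact ⟨div_pos hx this, div_pos (by linarith) this, this.ne'⟩
      · have : x - y < 0 := by linarith
        exact ⟨div_pos_of_neg_of_neg hx this, div_pos_of_neg_of_neg (by linarith) this, this.ne⟩
    obtain ⟨p₁, p₂, p₃⟩ := key h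
    obtain ⟨q₁, q₂, q₃⟩ := key h'
    have hrel : orient a b c - orient a b d = -(orient a c d - orient b c d) := by
      simp only [orient]; ring
    -- The witness is the point of `ab` where `orient c d` vanishes.
    refine ⟨(-orient b c d / (orient a c d - orient b c d)) • a
        + (orient a c d / (orient a c d - orient b c d)) • b,
      ⟨_, _, q₂, q₁, by field_simp; ring, rfl⟩, ⟨_, _, p₂, p₁, by field_simp; ring, ?_⟩⟩
    rw [hrel, div_neg, div_neg]
    ext i
    fin_cases i <;> simp <;> field_simp <;> simp only [orient] <;> ring

theorem ite_one_zero_congr {p q : Prop} {_ : Decidable p} {_ : Decidable q} (h : p ↔ q) :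
    (if p then (1 : ℤ) else 0) = if q then 1 else 0 := if_congr h rfl rfl

theorem card_inside_four {U : Finset Plane} (hU : GeneralPosition U) {a b c d : Plane}
    (hab : a ≠ b) (hac : a ≠ c) (had : a ≠ d) (hbc : b ≠ c) (hbd : b ≠ d) (hcd : c ≠ d)
    (hUeq : U = {a, b, c, d}) :
    (∑ x ∈ U, open Classical in if InsideCircle (U.erase x) x then (1 : ℤ) else 0)
      = 1 + open Classical in if SegmentsCross a b c d ∨ SegmentsCross a c b d ∨
          SegmentsCross a d b c then 1 else 0 := by
  classical
  have ha : a ∈ U := by simp [hUeq]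
  have hb : b ∈ U := by simp [hUeq]
  have hc : c ∈ U := by simp [hUeq]
  have hd : d ∈ U := by simp [hUeq]
  have oa := hU.orient_ne_zero hb hc hd hbc hbd hcd
  have ob := hU.orient_ne_zero ha hc hd hac had hcd
  have oc := hU.orient_ne_zero ha hb hd hab had hbd
  have od := hU.orient_ne_zero ha hb hc hab hac hbc
  have hI := hU.inCircle_ne_zero ha hb hc hd hab hac hbc had hbd hcd
  -- The signed areas are the coefficients of the affine dependence of the four points. Expanding
  -- the in-circle determinant around each point leaves the other three with positive weights.
  have key := four_sign oa (neg_ne_zero.2 ob) oc (neg_ne_zero.2 od) hI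
    (by simp only [orient]; ring)
    ⟨_, sqDist_pos hab.symm, _, sqDist_pos hac.symm, _, sqDist_pos had.symm, by
      linear_combination inCircle_eq a b c d a + orient b c d * sqDist_self a⟩
    ⟨_, sqDist_pos hab, _, sqDist_pos hbc.symm, _, sqDist_pos hbd.symm, by
      linear_combination inCircle_eq a b c d b - orient a c d * sqDist_self b⟩
    ⟨_, sqDist_pos hac, _, sqDist_pos hbc, _, sqDist_pos hcd.symm, by
      linear_combination inCircle_eq a b c d c + orient a b d * sqDist_self c⟩
    ⟨_, sqDist_pos had, _, sqDist_pos hbd, _, sqDist_pos hcd, by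
      linear_combination inCircle_eq a b c d d - orient a b c * sqDist_self d⟩
  have ea : U.erase a = {b, c, d} := by rw [hUeq]; ext x; simp; grind
  have eb : U.erase b = {a, c, d} := by rw [hUeq]; ext x; simp; grind
  have ec : U.erase c = {a, b, d} := by rw [hUeq]; ext x; simp; grind
  have ed : U.erase d = {a, b, c} := by rw [hUeq]; ext x; simp; grind
  have sum4 (f : Plane → ℤ) : ∑ x ∈ U, f x = f a + f b + f c + f d := by
    rw [hUeq, Finset.sum_insert (by simp [*]), Finset.sum_insert (by simp [*]),
      Finset.sum_pair hcd]
    ring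
  have ia : inCircle b c d a = -inCircle a b c d := by simp only [inCircle, orient]; ring
  have ib : inCircle a c d b = inCircle a b c d := by simp only [inCircle, orient]; ring
  have ic : inCircle a b d c = -inCircle a b c d := by simp only [inCircle, orient]; ring
  have oacb : orient a c b = -orient a b c := by simp only [orient]; ring
  have oabd : orient a d b = -orient a b d := by simp only [orient]; ring
  have oadc : orient a d c = -orient a c d := by simp only [orient]; ring
  have ocbd : orient c b d = -orient b c d := by simp only [orient]; ring
  have odbc : orient d b c = orient b c d := by simp only [orient]; ring
  rw [sum4, ea, eb, ec, ed]
  simp only [insideCircle_iff oa, insideCircle_iff ob, insideCircle_iff oc, insideCircle_iff od]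
  rw [segmentsCross_iff od ob, segmentsCross_iff (by simpa [oacb]) oc,
    segmentsCross_iff (by simpa [oabd]) od, ia, ib, ic, oacb, oabd, oadc, ocbd, odbc]
  refine Eq.trans (congrArg₂ (· + ·) (congrArg₂ (· + ·) (congrArg₂ (· + ·)
    (if_congr ?_ rfl rfl) (if_congr ?_ rfl rfl)) (if_congr ?_ rfl rfl)) (if_congr ?_ rfl rfl))
    (key.trans (congrArg₂ (· + ·) rfl (ite_one_zero_congr
      (or_congr (and_comm.trans (and_congr ?_ ?_))
        (or_congr (and_comm.trans (and_congr ?_ ?_)) (and_comm.trans (and_congr ?_ ?_)))))))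
  all_goals constructor <;> intro h <;> linarith

/-- The vertices of a pair of edges. -/
def pairVertices (P : Sym2 (Sym2 Plane)) : Finset Plane := P.toFinset.biUnion Sym2.toFinset

theorem pairVertices_mk (a b c d : Plane) : pairVertices s(s(a, b), s(c, d)) = {a, b, c, d} := by
  ext x; simp [pairVertices, Sym2.toFinset_mk_eq]; tauto

theorem pairing_eq {α : Type*} [DecidableEq α] {a b c d a' b' c' d' : α}
    (hab : a ≠ b) (hac : a ≠ c) (had : a ≠ d) (hbc : b ≠ c) (hbd : b ≠ d) (hcd : c ≠ d)
    (h : ({a, b, c, d} : Finset α) = {a', b', c', d'}) :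
    s(s(a, b), s(c, d)) = s(s(a', b'), s(c', d')) ∨ s(s(a, b), s(c, d)) = s(s(a', c'), s(b', d')) ∨
      s(s(a, b), s(c, d)) = s(s(a', d'), s(b', c')) := by
  have ha : a ∈ ({a', b', c', d'} : Finset α) := h ▸ by simp
  have hb : b ∈ ({a', b', c', d'} : Finset α) := h ▸ by simp
  have hc : c ∈ ({a', b', c', d'} : Finset α) := h ▸ by simp
  have hd : d ∈ ({a', b', c', d'} : Finset α) := h ▸ by simp
  clear h
  simp only [Finset.mem_insert, Finset.mem_singleton] at ha hb hc hd
  rcases ha with rfl | rfl | rfl | rfl <;> rcases hb with rfl | rfl | rfl | rfl <;>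
    first
    | contradiction
    | (rcases hc with rfl | rfl | rfl | rfl <;>
        first
        | contradiction
        | (rcases hd with rfl | rfl | rfl | rfl <;> first | contradiction | simp))

theorem segmentsCross_congr {a b c d a' b' c' d' : Plane}
    (h : s(s(a, b), s(c, d)) = s(s(a', b'), s(c', d'))) :
    SegmentsCross a b c d ↔ SegmentsCross a' b' c' d' := by
  simp only [Sym2.eq_iff] at h
  rcases h with ⟨⟨rfl, rfl⟩ | ⟨rfl, rfl⟩, ⟨rfl, rfl⟩ | ⟨rfl, rfl⟩⟩ |
    ⟨⟨rfl, rfl⟩ | ⟨rfl, rfl⟩, ⟨rfl, rfl⟩ | ⟨rfl, rfl⟩⟩ <;>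
  simp [segmentsCross_swap_left, segmentsCross_swap_right, segmentsCross_comm]

/-- With a shared end point, the weight relation would make three points collinear. -/
theorem SegmentsCross.ne {S : Finset Plane} (hS : GeneralPosition S) {a b c d : Plane}
    (ha : a ∈ S) (hb : b ∈ S) (hd : d ∈ S) (hab : a ≠ b) (hcd : c ≠ d)
    (hne : s(a, b) ≠ s(c, d)) (h : SegmentsCross a b c d) : a ≠ c := by
  rintro rfl
  obtain ⟨u, hu, v, hv, e⟩ := h.exists_weights
  have hbd : b ≠ d := fun h => hne (by rw [h])
  have h0 : orient a b a = 0 := by simp only [orient]; ring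
  rw [h0, mul_zero, zero_add] at e
  exact (mul_ne_zero hv.ne' (hS.orient_ne_zero ha hb hd hab hcd hbd)) e

/-- The vertices of a crossing pair of edges are four different points. -/
theorem SegmentsCross.distinct {S : Finset Plane} (hS : GeneralPosition S) {a b c d : Plane}
    (ha : a ∈ S) (hb : b ∈ S) (hc : c ∈ S) (hd : d ∈ S) (hab : a ≠ b) (hcd : c ≠ d)
    (hne : s(a, b) ≠ s(c, d)) (h : SegmentsCross a b c d) :
    a ≠ c ∧ a ≠ d ∧ b ≠ c ∧ b ≠ d := by
  refine ⟨h.ne hS ha hb hd hab hcd hne, ?_, ?_, ?_⟩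
  · exact (segmentsCross_swap_right.2 h).ne hS ha hb hc hab hcd.symm
      (by rwa [Sym2.eq_swap (a := d)])
  · exact (segmentsCross_swap_left.2 h).ne hS hb ha hd hab.symm hcd
      (by rwa [Sym2.eq_swap (a := b)])
  · exact (segmentsCross_swap_left.2 (segmentsCross_swap_right.2 h)).ne hS hb ha hc hab.symm
      hcd.symm (by rwa [Sym2.eq_swap (a := b), Sym2.eq_swap (a := d)])

/-- Two crossings would give `orient a b c` and `orient a c d` one sign, `orient a b d` and `orient
b c d` the other, although both pairs have the same sum. -/
theorem SegmentsCross.not_cross {S : Finset Plane} (hS : GeneralPosition S) {a b c d : Plane}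
    (ha : a ∈ S) (hb : b ∈ S) (hc : c ∈ S) (hd : d ∈ S) (hab : a ≠ b) (hac : a ≠ c) (had : a ≠ d)
    (hbc : b ≠ c) (hbd : b ≠ d) (hcd : c ≠ d) (h : SegmentsCross a b c d) :
    ¬ SegmentsCross a c b d := by
  intro h'
  have h1 := mul_neg_of_weights (hS.orient_ne_zero ha hb hc hab hac hbc) h.exists_weights
  have h2 := mul_neg_of_weights (hS.orient_ne_zero ha hc hb hac hab hbc.symm) h'.exists_weights
  have h3 := mul_neg_of_weights (hS.orient_ne_zero hc hd ha hcd hac.symm had.symm)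
    h.symm.exists_weights
  have h4 := mul_neg_of_weights (hS.orient_ne_zero hb hd ha hbd hab.symm had.symm)
    h'.symm.exists_weights
  have e₁ : orient a c b = -orient a b c := by simp only [orient]; ring
  have e₂ : orient c d a = orient a c d := by simp only [orient]; ring
  have e₃ : orient c d b = orient b c d := by simp only [orient]; ring
  have e₄ : orient b d a = orient a b d := by simp only [orient]; ring
  have e₅ : orient b d c = -orient b c d := by simp only [orient]; ring
  have hsum : orient b c d + orient a b d = orient a c d + orient a b c := by
    simp only [orient]; ring
  rw [e₁, neg_mul, neg_lt_zero] at h2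
  rw [e₂, e₃] at h3
  rw [e₄, e₅, mul_neg, neg_lt_zero] at h4
  rcases mul_neg_iff.1 h1 with ⟨p₁, p₂⟩ | ⟨p₁, p₂⟩
  · have p₃ := (pos_iff_pos_of_mul_pos h2).1 p₁
    have p₄ := neg_of_mul_neg_right h3 p₃.le
    linarith
  · have p₃ := (neg_iff_neg_of_mul_pos h2).1 p₁
    have p₄ := (pos_iff_pos_of_mul_pos h4).1 p₂
    linarith

/-- Some pair of edges spanned by the four points of `U` crosses. -/
def HasCrossing (U : Finset Plane) : Prop :=
  ∃ a b c d, U = {a, b, c, d} ∧ SegmentsCross a b c d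

open Finset in
theorem card_eq_four_distinct {α : Type*} [DecidableEq α] {a b c d : α}
    (h : ({a, b, c, d} : Finset α).card = 4) :
    a ≠ b ∧ a ≠ c ∧ a ≠ d ∧ b ≠ c ∧ b ≠ d ∧ c ≠ d := by
  have h3 : ∀ x y z : α, ({x, y, z} : Finset α).card ≤ 3 := fun x y z => card_le_three
  refine ⟨?_, ?_, ?_, ?_, ?_, ?_⟩ <;> rintro rfl
  · have := h3 a c d; simp at h; omega
  · have := h3 b a d
    rw [show ({a, b, a, d} : Finset α) = {b, a, d} by ext; simp] at h; omega
  · have := h3 a b c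
    rw [show ({a, b, c, a} : Finset α) = {a, b, c} by ext; simp; tauto] at h; omega
  · have := h3 a b d; simp at h; omega
  · have := h3 a b c
    rw [show ({a, b, c, b} : Finset α) = {a, b, c} by ext; simp; tauto] at h; omega
  · have := h3 a b c
    rw [show ({a, b, c, c} : Finset α) = {a, b, c} by ext; simp] at h; omega

theorem sum_inside_four {U : Finset Plane} (hU : GeneralPosition U) (hcard : U.card = 4) :
    (∑ x ∈ U, open Classical in if InsideCircle (U.erase x) x then (1 : ℤ) else 0)
      = 1 + open Classical in if HasCrossing U then 1 else 0 := by
  classical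
  obtain ⟨a, b, c, d, hab, hac, had, hbc, hbd, hcd, hUeq⟩ := Finset.card_eq_four.1 hcard
  rw [card_inside_four hU hab hac had hbc hbd hcd hUeq]
  congr 1
  refine if_congr ⟨?_, ?_⟩ rfl rfl
  · rintro (h | h | h)
    · exact ⟨a, b, c, d, hUeq, h⟩
    · exact ⟨a, c, b, d, by rw [hUeq]; ext; simp; tauto, h⟩
    · exact ⟨a, d, b, c, by rw [hUeq]; ext; simp; tauto, h⟩
  · rintro ⟨a', b', c', d', hUeq', h⟩
    obtain ⟨h1, h2, h3, h4, h5, h6⟩ := card_eq_four_distinct (hUeq' ▸ hcard)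
    rcases pairing_eq h1 h2 h3 h4 h5 h6 (hUeq'.symm.trans hUeq) with e | e | e
    · exact .inl ((segmentsCross_congr e).1 h)
    · exact .inr (.inl ((segmentsCross_congr e).1 h))
    · exact .inr (.inr ((segmentsCross_congr e).1 h))

-- A crossing pair of edges is determined by its four end points, because at most one of their three
-- perfect matchings crosses.
open Finset in
theorem crossingNumber_eq {S : Finset Plane} (hS : GeneralPosition S) :
    crossingNumber S = (open Classical in (S.powersetCard 4).filter HasCrossing).card := by
  classical
  rw [crossingNumber, ← Set.ncard_coe_finset]
  refine Set.ncard_congr (fun P _ => pairVertices P) ?_ ?_ ?_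
  · rintro P ⟨a, ha, b, hb, c, hc, d, hd, hab, hcd, hne, rfl, h⟩
    obtain ⟨hac, had, hbc, hbd⟩ := SegmentsCross.distinct hS ha hb hc hd hab hcd hne h
    rw [pairVertices_mk, coe_filter, Set.mem_ofPred_eq, mem_powersetCard]
    refine ⟨⟨?_, ?_⟩, a, b, c, d, rfl, h⟩
    · intro x; simp; rintro (rfl | rfl | rfl | rfl) <;> assumption
    · simp [*]
  · rintro P P' ⟨a, ha, b, hb, c, hc, d, hd, hab, hcd, hne, rfl, h⟩
      ⟨a', ha', b', hb', c', hc', d', hd', hab', hcd', hne', rfl, h'⟩ heq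
    obtain ⟨hac, had, hbc, hbd⟩ := SegmentsCross.distinct hS ha hb hc hd hab hcd hne h
    obtain ⟨hac', had', hbc', hbd'⟩ :=
      SegmentsCross.distinct hS ha' hb' hc' hd' hab' hcd' hne' h'
    rw [pairVertices_mk, pairVertices_mk] at heq
    rcases pairing_eq hab hac had hbc hbd hcd heq with e | e | e
    · exact e
    · exact absurd ((segmentsCross_congr e).1 h)
        (SegmentsCross.not_cross hS ha' hb' hc' hd' hab' hac' had' hbc' hbd' hcd' h')
    · exact absurd ((segmentsCross_congr e).1 h)
        ((segmentsCross_swap_right.2 h').not_cross hS ha' hb' hd' hc' hab' had' hac' hbd' hbc'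
          hcd'.symm)
  · intro U hU
    rw [coe_filter, Set.mem_ofPred_eq, mem_powersetCard] at hU
    obtain ⟨⟨hUS, hcard⟩, a, b, c, d, rfl, h⟩ := hU
    obtain ⟨h1, h2, h3, h4, h5, h6⟩ := card_eq_four_distinct hcard
    refine ⟨s(s(a, b), s(c, d)), ⟨a, hUS (by simp), b, hUS (by simp), c, hUS (by simp), d,
      hUS (by simp), h1, h6, ?_, rfl, h⟩, pairVertices_mk a b c d⟩
    simp only [ne_eq, Sym2.eq_iff]
    tauto

open Finset in
/-- The first moment of the number of points inside a circle through three of the points. -/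
theorem sum_insideCount {S : Finset Plane} (hS : GeneralPosition S) :
    ∑ t ∈ S.powersetCard 3, (insideCount S t : ℤ) = S.card.choose 4 + crossingNumber S := by
  classical
  simp only [insideCount_eq_sum]
  rw [sum_sdiff_eq_sum_erase S 3 fun t d => if InsideCircle t d then (1 : ℤ) else 0,
    sum_congr rfl fun U hU => by
      obtain ⟨hU, hc⟩ := mem_powersetCard.1 hU
      exact sum_inside_four (hS.mono hU) hc]
  rw [sum_add_distrib, crossingNumber_eq hS, card_filter, sum_const, card_powersetCard]
  simp

/-! ### Voronoi vertices as centers of circles through three points -/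

theorem dist_le_of_mem_closure_voronoiCell {S T : Finset Plane} {x : Plane}
    (hx : x ∈ closure (voronoiCell S T)) {p q : Plane} (hp : p ∈ T) (hq : q ∈ S) (hqT : q ∉ T) :
    dist p x ≤ dist q x := by
  have hcl : IsClosed {x : Plane | dist x p ≤ dist x q} :=
    isClosed_le (by fun_prop) (by fun_prop)
  have : dist x p ≤ dist x q :=
    closure_minimal (fun y hy => (hy p hp q hq hqT).le : voronoiCell S T ⊆ _) hcl hx
  rwa [dist_comm x p, dist_comm x q] at this

open Filter Topology in
/-- A point lies in the closure of a Voronoi cell if moving it in direction `v` breaks all ties. -/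
theorem mem_closure_voronoiCell {S T : Finset Plane} {x : Plane} (v : Plane)
    (h : ∀ p ∈ T, ∀ q ∈ S, q ∉ T → dist p x < dist q x ∨
      dist p x = dist q x ∧ v 0 * (q 0 - p 0) + v 1 * (q 1 - p 1) < 0) :
    x ∈ closure (voronoiCell S T) := by
  have hlim : Tendsto (fun ε : ℝ => x + ε • v) (𝓝[>] 0) (𝓝 x) := by
    have : Tendsto (fun ε : ℝ => x + ε • v) (𝓝 0) (𝓝 (x + (0 : ℝ) • v)) :=
      Continuous.tendsto (by fun_prop) 0
    simp only [zero_smul, add_zero] at this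
    exact this.mono_left nhdsWithin_le_nhds
  refine mem_closure_of_tendsto hlim ?_
  have hev : ∀ p ∈ T, ∀ q ∈ S, ∀ᶠ ε in 𝓝[>] (0 : ℝ),
      q ∉ T → dist (x + ε • v) p < dist (x + ε • v) q := by
    intro p hp q hq
    by_cases hqT : q ∈ T
    · simp [hqT]
    rcases h p hp q hq hqT with hlt | ⟨heq, hv⟩
    · have := (hlim.dist tendsto_const_nhds).eventually_lt (hlim.dist tendsto_const_nhds)
        (by simpa [dist_comm] using hlt : dist x p < dist x q)
      filter_upwards [this] with ε hε _ using hε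
    · filter_upwards [self_mem_nhdsWithin] with ε hε _
      -- The difference of the squared distances to `p` and `q` is affine in `ε`, with slope `2 v ·
      -- (q - p)`.
      rw [dist_eq_dist_iff] at heq
      rw [dist_lt_dist_iff]
      have := mul_neg_of_pos_of_neg (Set.mem_Ioi.1 hε) hv
      simp only [sqDist, PiLp.add_apply, PiLp.smul_apply, smul_eq_mul] at *
      linarith
  have := (Filter.eventually_all_finset T).2 fun p hp =>
    (Filter.eventually_all_finset S).2 fun q hq => hev p hp q hq
  filter_upwards [this] with ε hε p hp q hq hqT using hε p hp q hq hqT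

theorem exists_center_of_card_three {S t : Finset Plane} (hS : GeneralPosition S)
    (ht : t ∈ S.powersetCard 3) : ∃ x : Plane, ∃ r : ℝ, ∀ p ∈ t, dist p x = r := by
  obtain ⟨htS, hc⟩ := Finset.mem_powersetCard.1 ht
  obtain ⟨a, b, c, hab, hac, hbc, rfl⟩ := Finset.card_eq_three.1 hc
  obtain ⟨e, h1, h2⟩ := exists_center (hS.orient_ne_zero (htS (by simp)) (htS (by simp))
    (htS (by simp)) hab hac hbc)
  exact ⟨e, dist a e, by simp [dist_eq_dist_iff, h1, h2]⟩

theorem insideCircle_iff_dist_lt {S t : Finset Plane} (hS : GeneralPosition S)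
    (ht : t ∈ S.powersetCard 3) {x : Plane} {r : ℝ} (hx : ∀ p ∈ t, dist p x = r) (d : Plane) :
    InsideCircle t d ↔ dist d x < r := by
  refine ⟨?_, fun h => ⟨x, r, hx, h⟩⟩
  rintro ⟨y, s, hy, h⟩
  obtain ⟨htS, hc⟩ := Finset.mem_powersetCard.1 ht
  obtain ⟨a, b, c, hab, hac, hbc, rfl⟩ := Finset.card_eq_three.1 hc
  simp only [Finset.mem_insert, Finset.mem_singleton, forall_eq_or_imp, forall_eq] at hx hy
  have : x = y := center_unique (hS.orient_ne_zero (htS (by simp)) (htS (by simp))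
    (htS (by simp)) hab hac hbc) (dist_eq_dist_iff.1 (hx.2.1.trans hx.1.symm))
    (dist_eq_dist_iff.1 (hx.2.2.trans hx.1.symm)) (dist_eq_dist_iff.1 (hy.2.1.trans hy.1.symm))
    (dist_eq_dist_iff.1 (hy.2.2.trans hy.1.symm))
  subst this
  rwa [← hx.1, hy.1]

theorem insideCount_eq_card {S t : Finset Plane} (hS : GeneralPosition S)
    (ht : t ∈ S.powersetCard 3) {x : Plane} {r : ℝ} (hx : ∀ p ∈ t, dist p x = r) :
    insideCount S t = (S.filter fun d => dist d x < r).card := by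
  rw [insideCount]
  congr 1
  ext d
  simp only [Finset.mem_filter, Finset.mem_sdiff, insideCircle_iff_dist_lt hS ht hx]
  constructor
  · rintro ⟨⟨h, -⟩, h'⟩; exact ⟨h, h'⟩
  · rintro ⟨h, h'⟩; exact ⟨⟨h, fun hd => h'.ne (hx d hd)⟩, h'⟩

theorem card_filter_dist_eq_le {S : Finset Plane} (hS : GeneralPosition S) (x : Plane) (r : ℝ) :
    (S.filter fun d => dist d x = r).card ≤ 3 := by
  by_contra! h
  obtain ⟨T, hT, hc⟩ := Finset.exists_subset_card_eq (Nat.succ_le_of_lt h)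
  refine hS.2 T (hT.trans (Finset.filter_subset _ _)) hc ⟨x, r, fun p hp => ?_⟩
  exact (Finset.mem_filter.1 (hT hp)).2

open Finset in
theorem exists_mem_sdiff_of_card_eq {α : Type*} [DecidableEq α] {T₁ T₂ : Finset α}
    (h : T₁.card = T₂.card) (hne : T₁ ≠ T₂) : ∃ p ∈ T₁, p ∉ T₂ := by
  by_contra! hsub
  exact hne (eq_of_subset_of_card_le hsub h.ge)

/-- Here `m` counts the points tied at the critical distance and `j` the places left for them, so
`m.choose j` bounds the number of cells meeting there. -/
theorem eq_three_of_three_le_choose {m j : ℕ} (hm : m ≤ 3) (h : 3 ≤ m.choose j) :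
    m = 3 ∧ (j = 1 ∨ j = 2) := by
  have hj : j ≤ 3 := by
    by_contra! hj
    rw [Nat.choose_eq_zero_of_lt (by omega)] at h
    omega
  interval_cases m <;> interval_cases j <;> simp_all [Nat.choose]

-- Two distinct cells at `x` force a tie at some radius `r`. Every cell at `x` then takes all points
-- closer than `r`, none farther, and a fixed number `j` of the tied ones; three cells require three
-- tied points and `j = 1` or `j = 2`.
open Finset in
theorem exists_circle_of_mem_voronoiVertices {S : Finset Plane} (hS : GeneralPosition S) {k : ℕ}
    {x : Plane} (hx : x ∈ voronoiVertices S k) :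
    ∃ t ∈ S.powersetCard 3, (∃ r, ∀ p ∈ t, dist p x = r) ∧
      (insideCount S t + 1 = k ∨ insideCount S t + 2 = k) := by
  set V : Set (Finset Plane) := {T | T ⊆ S ∧ T.card = k ∧ x ∈ closure (voronoiCell S T)} with hV
  have hx3 : 3 ≤ V.encard := hx
  obtain ⟨T₁, T₂, hT₁, hT₂, hne⟩ :=
    Set.one_lt_encard_iff.1 (lt_of_lt_of_le (by norm_num) hx3)
  have hle : ∀ T ∈ V, ∀ p ∈ T, ∀ q ∈ S, q ∉ T → dist p x ≤ dist q x :=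
    fun T hT p hp q hq hqT => dist_le_of_mem_closure_voronoiCell hT.2.2 hp hq hqT
  have tie : ∀ T ∈ V, ∀ T' ∈ V, T ≠ T' → ∃ p ∈ T, ∃ q ∈ T', p ∉ T' ∧ q ∉ T ∧
      dist p x = dist q x := by
    intro T hT T' hT' hne
    obtain ⟨p, hp, hp'⟩ := exists_mem_sdiff_of_card_eq (hT.2.1.trans hT'.2.1.symm) hne
    obtain ⟨q, hq, hq'⟩ := exists_mem_sdiff_of_card_eq (hT'.2.1.trans hT.2.1.symm) hne.symm
    exact ⟨p, hp, q, hq, hp', hq', le_antisymm (hle T hT p hp q (hT'.1 hq) hq')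
      (hle T' hT' q hq p (hT.1 hp) hp')⟩
  obtain ⟨p, hp, q, hq, hp', hq', hpq⟩ := tie T₁ hT₁ T₂ hT₂ hne
  set r := dist p x with hr
  set I := S.filter fun d => dist d x < r with hI
  set E := S.filter fun d => dist d x = r with hE
  have between : ∀ T ∈ V, ∀ p ∈ T, ∀ q ∈ S, q ∉ T → dist p x = r → dist q x = r →
      I ⊆ T ∧ ∀ d ∈ T, dist d x ≤ r := by
    intro T hT p hp q hq hqT hpr hqr
    refine ⟨fun d hd => ?_, fun d hd => hqr ▸ hle T hT d hd q hq hqT⟩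
    by_contra hdT
    obtain ⟨hdS, hlt⟩ := mem_filter.1 hd
    exact absurd (hle T hT p hp d hdS hdT) (by rw [hpr]; exact not_le.2 hlt)
  obtain ⟨hI₁, hd₁⟩ := between T₁ hT₁ p hp q (hT₂.1 hq) hq' rfl hpq.symm
  -- A tie between `T₁` and any other cell is again at radius `r`: the point in `T₁` is at distance
  -- at most `r`, the one outside at least `r`.
  have hall : ∀ T ∈ V, I ⊆ T ∧ ∀ d ∈ T, dist d x ≤ r := by
    intro T hT
    by_cases hTT : T₁ = T
    · exact hTT ▸ ⟨hI₁, hd₁⟩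
    · obtain ⟨a, ha, b, hb, ha', hb', hab⟩ := tie T₁ hT₁ T hT hTT
      have h1 := hd₁ a ha
      have h2 : r ≤ dist b x := not_lt.1 fun hlt => hb' (hI₁ (mem_filter.2 ⟨hT.1 hb, hlt⟩))
      exact between T hT b hb a (hT₁.1 ha) ha' (le_antisymm (hab ▸ h1) h2)
        (le_antisymm h1 (hab ▸ h2))
  have hVsub : V ⊆ ((E.powersetCard (k - I.card)).image (I ∪ ·) : Finset (Finset Plane)) := by
    intro T hT
    obtain ⟨h1, h2⟩ := hall T hT
    rw [mem_coe, mem_image]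
    refine ⟨T \ I, mem_powersetCard.2 ⟨fun d hd => ?_, ?_⟩, union_sdiff_of_subset h1⟩
    · obtain ⟨hdT, hdI⟩ := mem_sdiff.1 hd
      exact mem_filter.2 ⟨hT.1 hdT, le_antisymm (h2 d hdT)
        (not_lt.1 fun hlt => hdI (mem_filter.2 ⟨hT.1 hdT, hlt⟩))⟩
    · rw [card_sdiff_of_subset h1, hT.2.1]
  have hchoose : 3 ≤ E.card.choose (k - I.card) := by
    have h1 := hx3.trans (Set.encard_le_encard hVsub)
    rw [Set.encard_coe_eq_coe_finsetCard] at h1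
    rw [← card_powersetCard]
    exact le_trans (by exact_mod_cast h1) card_image_le
  have hE3 := card_filter_dist_eq_le hS x r
  rw [← hE] at hE3
  have hcase := eq_three_of_three_le_choose hE3 hchoose
  have hEt : E ∈ S.powersetCard 3 := mem_powersetCard.2 ⟨filter_subset _ _, hcase.1⟩
  have hEr : ∀ d ∈ E, dist d x = r := fun d hd => (mem_filter.1 hd).2
  refine ⟨E, hEt, ⟨r, hEr⟩, ?_⟩
  rw [insideCount_eq_card hS hEt hEr, ← hI]
  rcases hcase.2 with h | h
  · left; omega
  · right; omega

-- Moving from `x` towards `a ∈ t` selects `a` alone among the tied points, and moving away from `a`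
-- selects the other two; the three choices of `a` give three cells.
open Finset in
theorem mem_voronoiVertices_of_circle {S : Finset Plane} (hS : GeneralPosition S) {k : ℕ}
    {x : Plane} {t : Finset Plane} (ht : t ∈ S.powersetCard 3) {r : ℝ}
    (hx : ∀ p ∈ t, dist p x = r) (hk : insideCount S t + 1 = k ∨ insideCount S t + 2 = k) :
    x ∈ voronoiVertices S k := by
  obtain ⟨htS, hc⟩ := mem_powersetCard.1 ht
  rw [insideCount_eq_card hS ht hx] at hk
  set I := S.filter fun d => dist d x < r with hI
  have hIS : I ⊆ S := filter_subset _ _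
  have hIt : ∀ p ∈ t, p ∉ I := fun p hp h => (mem_filter.1 h).2.ne (hx p hp)
  have hIlt : ∀ p ∈ I, dist p x < r := fun p hp => (mem_filter.1 hp).2
  have hIge : ∀ q ∈ S, q ∉ I → r ≤ dist q x := fun q hq hqI =>
    not_lt.1 fun h => hqI (mem_filter.2 ⟨hq, h⟩)
  have hout : ∀ q ∈ S, q ∉ I → q ∉ t → r < dist q x := by
    intro q hq hqI hqt
    refine lt_of_le_of_ne (hIge q hq hqI) fun h => ?_
    have h3 := card_filter_dist_eq_le hS x r
    have hsub : insert q t ⊆ S.filter fun d => dist d x = r := by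
      intro p hp
      rcases mem_insert.1 hp with rfl | hp
      · exact mem_filter.2 ⟨hq, h.symm⟩
      · exact mem_filter.2 ⟨htS hp, hx p hp⟩
    have := card_le_card hsub
    rw [card_insert_of_notMem hqt] at this
    omega
  have hdir : ∀ a ∈ t, ∀ b ∈ t, b ≠ a →
      (a 0 - x 0) * (b 0 - a 0) + (a 1 - x 1) * (b 1 - a 1) < 0 := by
    intro a ha b hb hba
    have h1 := dist_eq_dist_iff.1 ((hx b hb).trans (hx a ha).symm)
    have h2 := sqDist_pos hba
    simp only [sqDist] at h1 h2
    linarith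
  have main : ∀ f : Plane → Finset Plane, Set.InjOn f t →
      (∀ a ∈ t, f a ⊆ S ∧ (f a).card = k ∧ x ∈ closure (voronoiCell S (f a))) →
      x ∈ voronoiVertices S k := by
    intro f hf h
    have hsub : ((t.image f : Finset (Finset Plane)) : Set (Finset Plane)) ⊆
        {T | T ⊆ S ∧ T.card = k ∧ x ∈ closure (voronoiCell S T)} := by
      intro T hT
      obtain ⟨a, ha, rfl⟩ := mem_image.1 (mem_coe.1 hT)
      exact h a ha
    have := Set.encard_le_encard hsub
    rw [Set.encard_coe_eq_coe_finsetCard, card_image_of_injOn hf, hc] at this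
    exact this
  rcases hk with hk | hk
  · refine main (fun a => insert a I) ?_ fun a ha => ⟨insert_subset (htS ha) hIS, ?_, ?_⟩
    · intro a ha b hb hab
      have : a ∈ insert b I := (show insert a I = insert b I from hab) ▸ mem_insert_self a I
      exact (mem_insert.1 this).resolve_right (hIt a ha)
    · rw [card_insert_of_notMem (hIt a ha), hk]
    · refine mem_closure_voronoiCell (a - x) fun p hp q hq hqT => ?_
      simp only [mem_insert, not_or] at hqT
      rcases mem_insert.1 hp with rfl | hp
      · by_cases hqt : q ∈ t
        · right
          refine ⟨(hx p ha).trans (hx q hqt).symm, ?_⟩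
          simpa using hdir p ha q hqt hqT.1
        · left
          rw [hx p ha]
          exact hout q hq hqT.2 hqt
      · exact .inl ((hIlt p hp).trans_le (hIge q hq hqT.2))
  · refine main (fun a => I ∪ t.erase a) ?_ fun a ha =>
      ⟨union_subset hIS ((erase_subset _ _).trans htS), ?_, ?_⟩
    · intro a ha b hb hab
      by_contra hne
      have : a ∈ I ∪ t.erase a := (show I ∪ t.erase a = I ∪ t.erase b from hab) ▸
        mem_union_right _ (mem_erase.2 ⟨hne, ha⟩)
      rcases mem_union.1 this with h | h
      · exact hIt a ha h
      · exact notMem_erase _ _ h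
    · rw [card_union_of_disjoint, card_erase_of_mem ha, hc, ← hk]
      exact disjoint_right.2 fun p hp => hIt p (mem_of_mem_erase hp)
    · refine mem_closure_voronoiCell (x - a) fun p hp q hq hqT => ?_
      simp only [mem_union, mem_erase, not_or, not_and] at hqT
      rcases mem_union.1 hp with hp | hp
      · exact .inl ((hIlt p hp).trans_le (hIge q hq hqT.1))
      · obtain ⟨hpa, hpt⟩ := mem_erase.1 hp
        by_cases hqt : q ∈ t
        · right
          obtain rfl : q = a := by
            by_contra h
            exact hqT.2 h hqt
          refine ⟨(hx p hpt).trans (hx q hqt).symm, ?_⟩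
          have := hdir q hqt p hpt hpa
          simp only [PiLp.sub_apply]
          linarith
        · left
          rw [hx p hpt]
          exact hout q hq hqT.1 hqt

-- Concentric circles through different triples are possible, but the larger one also contains the
-- three points of the smaller. The counts then differ by at least 3, too much for a common order.
open Finset in
theorem circle_unique_of_center {S : Finset Plane} (hS : GeneralPosition S) {k : ℕ}
    {x : Plane} {t t' : Finset Plane} (ht : t ∈ S.powersetCard 3) (ht' : t' ∈ S.powersetCard 3)
    {r r' : ℝ} (hx : ∀ p ∈ t, dist p x = r) (hx' : ∀ p ∈ t', dist p x = r')
    (hk : insideCount S t + 1 = k ∨ insideCount S t + 2 = k)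
    (hk' : insideCount S t' + 1 = k ∨ insideCount S t' + 2 = k) : t = t' := by
  have aux : ∀ {t t' : Finset Plane} (ht : t ∈ S.powersetCard 3) (ht' : t' ∈ S.powersetCard 3)
      {r r' : ℝ} (hx : ∀ p ∈ t, dist p x = r) (hx' : ∀ p ∈ t', dist p x = r'), r < r' →
      insideCount S t + 3 ≤ insideCount S t' := by
    intro t t' ht ht' r r' hx hx' hlt
    rw [insideCount_eq_card hS ht hx, insideCount_eq_card hS ht' hx',
      ← (mem_powersetCard.1 ht).2, ← card_union_of_disjoint]
    · refine card_le_card (union_subset (fun d hd => ?_) fun d hd => ?_)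
      · exact mem_filter.2 ⟨(mem_filter.1 hd).1, (mem_filter.1 hd).2.trans hlt⟩
      · exact mem_filter.2 ⟨(mem_powersetCard.1 ht).1 hd, (hx d hd).trans_lt hlt⟩
    · exact disjoint_right.2 fun p hp h => (mem_filter.1 h).2.ne (hx p hp)
  rcases lt_trichotomy r r' with h | rfl | h
  · have := aux ht ht' hx hx' h
    omega
  · have h3 := card_filter_dist_eq_le hS x r
    have key : ∀ {t}, t ∈ S.powersetCard 3 → (∀ p ∈ t, dist p x = r) →
        t = S.filter fun d => dist d x = r := by
      intro t ht hx
      obtain ⟨htS, hc⟩ := mem_powersetCard.1 ht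
      exact eq_of_subset_of_card_le (fun d hd => mem_filter.2 ⟨htS hd, hx d hd⟩) (hc ▸ h3)
    rw [key ht hx, key ht' hx']
  · have := aux ht' ht hx' hx h
    omega

open Finset in
/-- Each circle through three points of `S` contributes one vertex to the Voronoi diagrams of two
consecutive orders. -/
theorem voronoiVertices_finite_and_ncard {S : Finset Plane} (hS : GeneralPosition S) (k : ℕ) :
    (voronoiVertices S k).Finite ∧ (voronoiVertices S k).ncard =
      ((S.powersetCard 3).filter fun t => insideCount S t + 1 = k ∨ insideCount S t + 2 = k).card := by
  classical
  choose! c hc using fun t (ht : t ∈ S.powersetCard 3) => exists_center_of_card_three hS ht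
  choose! r hr using hc
  set A := (S.powersetCard 3).filter fun t => insideCount S t + 1 = k ∨ insideCount S t + 2 = k
  have hA : voronoiVertices S k = (A.image c : Finset Plane) := by
    ext x
    rw [mem_coe, mem_image]
    constructor
    · intro hx
      obtain ⟨t, ht, ⟨s, hs⟩, hk⟩ := exists_circle_of_mem_voronoiVertices hS hx
      refine ⟨t, mem_filter.2 ⟨ht, hk⟩, ?_⟩
      obtain ⟨htS, h3⟩ := mem_powersetCard.1 ht
      have hrt := hr t ht
      generalize c t = y at *
      obtain ⟨p, q, u, hpq, hpu, hqu, rfl⟩ := card_eq_three.1 h3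
      simp only [mem_insert, mem_singleton, forall_eq_or_imp, forall_eq] at hs hrt
      exact center_unique (hS.orient_ne_zero (htS (by simp)) (htS (by simp)) (htS (by simp)) hpq
        hpu hqu) (dist_eq_dist_iff.1 (hrt.2.1.trans hrt.1.symm))
        (dist_eq_dist_iff.1 (hrt.2.2.trans hrt.1.symm))
        (dist_eq_dist_iff.1 (hs.2.1.trans hs.1.symm))
        (dist_eq_dist_iff.1 (hs.2.2.trans hs.1.symm))
    · rintro ⟨t, ht, rfl⟩
      obtain ⟨ht, hk⟩ := mem_filter.1 ht
      exact mem_voronoiVertices_of_circle hS ht (hr t ht) hk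
  rw [hA, Set.ncard_coe_finset, card_image_of_injOn]
  · exact ⟨finite_toSet _, rfl⟩
  · intro t ht t' ht' heq
    obtain ⟨ht, hk⟩ := mem_filter.1 (mem_coe.1 ht)
    obtain ⟨ht', hk'⟩ := mem_filter.1 (mem_coe.1 ht')
    exact circle_unique_of_center hS ht ht' (hr t ht) (fun p hp => heq ▸ hr t' ht' p hp) hk hk'

/-! ### The Voronoi polynomial and its values -/

open Finset in
theorem voronoiPolynomial_eq_sum {S : Finset Plane} (hS : GeneralPosition S) :
    voronoiPolynomial S
      = ∑ t ∈ S.powersetCard 3, (X ^ insideCount S t + X ^ (insideCount S t + 1) : ℝ[X]) := by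
  classical
  have hle : ∀ t ∈ S.powersetCard 3, insideCount S t + 3 ≤ S.card := by
    intro t ht
    obtain ⟨htS, hc⟩ := mem_powersetCard.1 ht
    have h1 : insideCount S t ≤ (S \ t).card := card_filter_le _ _
    have h2 := card_sdiff_add_card_eq_card htS
    omega
  have h1 : voronoiPolynomial S = ∑ k ∈ Icc 1 (S.card - 1), ∑ t ∈ S.powersetCard 3,
      if insideCount S t + 1 = k ∨ insideCount S t + 2 = k then (X ^ (k - 1) : ℝ[X]) else 0 := by
    refine sum_congr rfl fun k _ => ?_
    rw [(voronoiVertices_finite_and_ncard hS k).2, ← sum_filter, sum_const, nsmul_eq_mul]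
    simp
  rw [h1, sum_comm]
  refine sum_congr rfl fun t ht => ?_
  have := hle t ht
  rw [← sum_filter]
  -- Both orders lie in the range of summation because at most `n - 3` points are inside the circle.
  have hset : (Icc 1 (S.card - 1)).filter
      (fun k => insideCount S t + 1 = k ∨ insideCount S t + 2 = k)
      = {insideCount S t + 1, insideCount S t + 2} := by
    ext k; simp; omega
  rw [hset, sum_pair (by omega)]
  rfl

theorem mainTheorem8 (n : ℕ) (hn : 4 ≤ n) (S : Finset Plane) (hS : S.card = n)
    (hgen : GeneralPosition S) :
    (∀ k ∈ Finset.Icc 1 (n - 1), (voronoiVertices S k).Finite) ∧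
    (voronoiPolynomial S).eval 1 = 2 * (n.choose 3 : ℝ) ∧
    (voronoiPolynomial S).derivative.eval 1
      = (n.choose 3 : ℝ) + 2 * (n.choose 4 : ℝ) + 2 * (crossingNumber S : ℝ) ∧
    (voronoiPolynomial S).derivative.derivative.eval 1
      = 2 * (n.choose 4 : ℝ) + 2 * (n.choose 5 : ℝ) + 2 * ((n : ℝ) - 3) * (crossingNumber S : ℝ) ∧
    (voronoiPolynomial S).eval (-1) = 0 ∧
    (Odd n → (voronoiPolynomial S).derivative.eval (-1) = ((n : ℝ) - 1) / 2) := by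
  subst hS
  set n := S.card with hn'
  have hcard : (∑ t ∈ S.powersetCard 3, (1 : ℝ)) = n.choose 3 := by simp [hn']
  have hm1 : ∑ t ∈ S.powersetCard 3, (insideCount S t : ℝ) = n.choose 4 + crossingNumber S := by
    exact_mod_cast sum_insideCount hgen
  have hm2 : ∑ t ∈ S.powersetCard 3,
      (((n : ℝ) - 3 - 2 * insideCount S t) ^ 2 - ((n : ℝ) - 3)) = 4 * (n.choose 5 : ℝ) := by
    exact_mod_cast sum_sq_insideCount hgen
  have hc4 : (n.choose 4 : ℝ) * 4 = n.choose 3 * ((n : ℝ) - 3) := by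
    have := congrArg (Nat.cast : ℕ → ℝ) (Nat.choose_succ_right_eq n 3)
    rw [Nat.cast_mul, Nat.cast_mul, Nat.cast_sub (by omega)] at this
    exact_mod_cast this
  have hsq : ∑ t ∈ S.powersetCard 3, (insideCount S t : ℝ) ^ 2
      = n.choose 4 + n.choose 5 + ((n : ℝ) - 3) * crossingNumber S := by
    have : ∑ t ∈ S.powersetCard 3, (((n : ℝ) - 3 - 2 * insideCount S t) ^ 2 - ((n : ℝ) - 3))
        = 4 * ∑ t ∈ S.powersetCard 3, (insideCount S t : ℝ) ^ 2
          - 4 * ((n : ℝ) - 3) * ∑ t ∈ S.powersetCard 3, (insideCount S t : ℝ)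
          + ((n : ℝ) - 3) * ((n : ℝ) - 4) * ∑ t ∈ S.powersetCard 3, (1 : ℝ) := by
      rw [Finset.mul_sum, Finset.mul_sum, Finset.mul_sum, ← Finset.sum_sub_distrib,
        ← Finset.sum_add_distrib]
      exact Finset.sum_congr rfl fun t _ => by ring
    rw [hm2, hm1, hcard] at this
    -- The `hc4` term eliminates `n.choose 3` in favor of `n.choose 4`.
    linear_combination (-1/4) * this + ((n : ℝ) - 4) / 4 * hc4
  rw [voronoiPolynomial_eq_sum hgen]
  simp only [eval_finsetSum, derivative_sum, derivative_add, eval_add, eval_pow, eval_X,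
    derivative_X_pow, eval_mul, derivative_mul, one_pow, mul_one, map_natCast]
  refine ⟨fun k _ => (voronoiVertices_finite_and_ncard hgen k).1, ?_, ?_, ?_, ?_, ?_⟩
  · rw [← hcard, Finset.mul_sum]
    norm_num
  · have : (n.choose 3 : ℝ) + 2 * n.choose 4 + 2 * crossingNumber S
        = ∑ t ∈ S.powersetCard 3, (1 + 2 * (insideCount S t : ℝ)) := by
      rw [Finset.sum_add_distrib, ← Finset.mul_sum, hcard, hm1]; ring
    rw [this]
    refine Finset.sum_congr rfl fun t _ => ?_
    simp
    ring
  · have : 2 * (n.choose 4 : ℝ) + 2 * (n.choose 5 : ℝ) + 2 * ((n : ℝ) - 3) * crossingNumber S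
        = ∑ t ∈ S.powersetCard 3, 2 * (insideCount S t : ℝ) ^ 2 := by
      rw [← Finset.mul_sum, hsq]; ring
    rw [this]
    refine Finset.sum_congr rfl fun t _ => ?_
    -- The second derivative at `1` is `c (c - 1) + (c + 1) c = 2 c ^ 2`; the case `c = 0` is
    -- separate because of truncated subtraction in the exponents.
    rcases insideCount S t with _ | m
    · simp
    · simp
      ring
  · refine Finset.sum_eq_zero fun t _ => ?_
    ring
  · intro hodd
    have h : (2 : ℝ) * ∑ t ∈ S.powersetCard 3, (-1 : ℝ) ^ insideCount S t = n - 1 := by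
      exact_mod_cast sum_neg_one_pow_insideCount hgen hodd
    rw [eq_div_iff two_ne_zero, mul_comm, ← h]
    congr 1
    refine Finset.sum_congr rfl fun t _ => ?_
    -- At `-1` only differentiating the factor `1 + z` of `(1 + z) z ^ c` survives, leaving `(-1) ^
    -- c`.
    rcases insideCount S t with _ | m
    · simp
    · simp
      ring

end
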